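/- For $z$ in the upper half plane let \[ \Theta_{01}(z)=\sum_{n\in\mathbb Z}(-1)^n e^{\pi i n^2 z},\qquad \Theta_{10}(z)=\sum_{n\in\mathbb Z}e^{\pi i (n+1/2)^2 z}, \] let $\Delta=(E_4^3-E_6^2)/1728$ be the modular discriminant, where $E_4$ and $E_6$ are the Eisenstein series for $\mathrm{SL}_2(\mathbb Z)$ normalized to have constant term $1$, and let \[ \psi_I=\frac{7\,\Theta_{01}^{20}\Theta_{10}^{8}+7\,\Theta_{01}^{24}\Theta_{10}^{4}+2\,\Theta_{01}^{28}}{\Delta^2}. \] For real $r>2$ the integral in \[ b(r)=-4\sin\left(\pi r^2/2\right)^2\int_0^{i\infty}\psi_I(z)\,e^{\pi i r^2 z}\,dz \] (taken along the positive imaginary axis) converges absolutely. The function $r\mapsto b(r)$, $r>2$, analytically continues to a holomorphic function on an open neighborhood of $\mathbb R$ in $\mathbb C$. The restriction of this continuation to $\mathbb R$ is a Schwartz function, and $x\mapsto b(|x|)$ on $\mathbb R^{24}$ (with $b$ denoting the continuation) is a Schwartz function that is a radial eigenfunction, not identically zero, of the Fourier transform $\widehat f(y)=\int_{\mathbb R^{24}}f(x)e^{-2\pi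 i\langle x,y\rangle}\,dx$ with eigenvalue $-1$. -/

import Mathlib

noncomputable section

namespace LeechEigenfunction

open Complex UpperHalfPlane MeasureTheory

/-- `Θ₀₁(z) = ∑_{n ∈ ℤ} (-1)ⁿ e^{π i n² z}` on the upper half plane. -/
def Theta01 (z : ℍ) : ℂ :=
  ∑' n : ℤ, (-1 : ℂ) ^ n * cexp (Real.pi * Complex.I * (n : ℂ) ^ 2 * (z : ℂ))

/-- `Θ₁₀(z) = ∑_{n ∈ ℤ} e^{π i (n + 1/2)² z}` on the upper half plane. -/
def Theta10 (z : ℍ) : ℂ :=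
  ∑' n : ℤ, cexp (Real.pi * Complex.I * ((n : ℂ) + 1 / 2) ^ 2 * (z : ℂ))

/-- `ψ_I = (7 Θ₀₁²⁰ Θ₁₀⁸ + 7 Θ₀₁²⁴ Θ₁₀⁴ + 2 Θ₀₁²⁸) / Δ²`, where `Δ = (E₄³ - E₆²) / 1728` is the
modular discriminant (see `ModularForm.discriminant_eq_E₄_cube_sub_E₆_sq` for this formula). -/
def psiI (z : ℍ) : ℂ :=
  (7 * Theta01 z ^ 20 * Theta10 z ^ 8 + 7 * Theta01 z ^ 24 * Theta10 z ^ 4 + 2 * Theta01 z ^ 28) /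
    ModularForm.discriminant z ^ 2

/-- The integrand `ψ_I(z) e^{π i r² z}`, as a function of a complex number `z` which is meant to
lie in the upper half plane. -/
def bIntegrand (r : ℝ) (z : ℂ) : ℂ :=
  psiI (ofComplex z) * cexp (Real.pi * Complex.I * (r : ℂ) ^ 2 * z)

/-- `b(r) = -4 sin(π r² / 2)² ∫_0^{i∞} ψ_I(z) e^{π i r² z} dz`; the integral is along the positive
imaginary axis `z = i t`, `dz = i dt`. It is meaningful for `r > 2`. -/
def b (r : ℝ) : ℂ :=
  -4 * ((Real.sin (Real.pi * r ^ 2 / 2) : ℝ) : ℂ) ^ 2 *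
    ∫ t in Set.Ioi (0 : ℝ), bIntegrand r (Complex.I * (t : ℂ)) * Complex.I

end LeechEigenfunction

end

open scoped SchwartzMap FourierTransform

/-! Write `phiS` for the image of `phiI` under the weight `-10` action of `z ↦ -1/z`. Jacobi's
identity makes `phiS` antiperiodic and gives `phiI (z ± 1) = phiI z - phiS z`. With `ρ = r²`, `-4
sin² (πρ/2) = exp (πiρ) + exp (-πiρ) - 2`, so `b` is a combination of three integrals of `phiI`,
along the imaginary axis and its translates by `σ = ±1`. On the translates the integrand becomes
`phiI - phiS`, and the contour is bent to run along the unit circle from `σ` to `i` and then up to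
`i∞` (`contour_shift`).

On the common ray above `i` all `phiI` terms cancel. What remains (`bCont`) is two arcs, the segment
from `i` to `0` and the ray from `i` to `i∞`, each a superposition of Gaussians `exp (πi r² z)`
whose amplitude involves only `phiS` and decays like `exp (-πs)`. Hence `bCont` is holomorphic and
rapidly decreasing in `w = r²` beyond the half-line `w ≥ 0`, and Cauchy estimates turn this into
Schwartz bounds.

In dimension 24 the Fourier transform sends `exp (πi|x|²z)` to `z⁻¹² exp (πi|y|²(-1/z))`. Inversion
swaps the two arcs and swaps the segment with the ray, each time with amplitude multiplied by `-1`: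
eigenvalue `-1`. For nonvanishing, `phiI` is nonnegative on the imaginary axis and positive high up,
so `b √5 ≠ 0`. -/

noncomputable section

namespace LeechEigenfunction

open UpperHalfPlane hiding I
open Complex MeasureTheory Filter Topology

/-! ### Theta functions, the discriminant and their transformation laws. -/

/-- `Θ₀₀ = ∑ exp (π i n² z)`, as a function on `ℂ`. -/
def th00 (z : ℂ) : ℂ := jacobiTheta₂ 0 z

/-- `Θ₀₁ = ∑ (-1)ⁿ exp (π i n² z)`, as a function on `ℂ`. -/
def th01 (z : ℂ) : ℂ := jacobiTheta₂ (1 / 2) z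

/-- `Θ₁₀ = ∑ exp (π i (n + 1/2)² z)`, as a function on `ℂ`. -/
def th10 (z : ℂ) : ℂ := cexp (Real.pi * I * z / 4) * jacobiTheta₂ (z / 2) z

/-- The modular discriminant as a function on `ℂ`. -/
def disc (z : ℂ) : ℂ := ModularForm.eta z ^ 24

/-- `ψ_I` as a function on `ℂ`. -/
def phiI (z : ℂ) : ℂ :=
  (7 * th01 z ^ 20 * th10 z ^ 8 + 7 * th01 z ^ 24 * th10 z ^ 4 + 2 * th01 z ^ 28) / disc z ^ 2

/-- `ψ_S = ψ_I |₋₁₀ S` as a function on `ℂ`. -/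
def phiS (z : ℂ) : ℂ :=
  -(7 * th10 z ^ 20 * th01 z ^ 8 + 7 * th10 z ^ 24 * th01 z ^ 4 + 2 * th10 z ^ 28) / disc z ^ 2

lemma Theta01_eq (τ : ℍ) : Theta01 τ = th01 τ := by
  refine tsum_congr fun n => ?_
  rw [jacobiTheta₂_term, Complex.exp_add]
  congr 1
  rw [show (2 * Real.pi * I * n * (1 / 2) : ℂ) = n * (Real.pi * I) by ring, Complex.exp_int_mul,
    Complex.exp_pi_mul_I]

lemma Theta10_eq (τ : ℍ) : Theta10 τ = th10 τ := by
  rw [Theta10, th10, jacobiTheta₂, ← tsum_mul_left]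
  refine tsum_congr fun n => ?_
  rw [jacobiTheta₂_term, ← Complex.exp_add]
  congr 1
  ring

lemma psiI_ofComplex {z : ℂ} (hz : 0 < z.im) : psiI (ofComplex z) = phiI z := by
  have : ((ofComplex z : ℍ) : ℂ) = z := by simp [ofComplex_apply_of_im_pos hz]
  rw [psiI, phiI, Theta01_eq, Theta10_eq, ModularForm.discriminant, this, disc]

/-- Holds because `n² ≡ n` modulo `2`. -/
lemma th00_add_one (z : ℂ) : th00 (z + 1) = th01 z := by
  refine tsum_congr fun n => ?_
  rw [jacobiTheta₂_term, jacobiTheta₂_term]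
  have h : cexp (Real.pi * I * (n ^ 2 : ℂ)) = cexp (Real.pi * I * n) := by
    rw [Complex.exp_eq_exp_iff_exists_int]
    obtain ⟨k, hk⟩ : ∃ k : ℤ, n ^ 2 = n + k * 2 := by
      obtain ⟨k, hk⟩ := Int.even_mul_succ_self (n - 1)
      exact ⟨k, by linarith⟩
    refine ⟨k, ?_⟩
    have hk' : ((n : ℂ)) ^ 2 = n + k * 2 := by exact_mod_cast hk
    rw [hk']; ring
  rw [show (2 * Real.pi * I * n * 0 + Real.pi * I * n ^ 2 * (z + 1) : ℂ)
    = Real.pi * I * n ^ 2 + Real.pi * I * n ^ 2 * z by ring, Complex.exp_add, Complex.exp_add, h]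
  congr 2
  ring

lemma th01_add_one (z : ℂ) : th01 (z + 1) = th00 z := by
  rw [← th00_add_one, th00, th00, add_assoc, one_add_one_eq_two, jacobiTheta₂_add_right]

lemma th10_add_one (z : ℂ) : th10 (z + 1) = cexp (Real.pi * I / 4) * th10 z := by
  rw [th10, th10, show (Real.pi * I * (z + 1) / 4 : ℂ)
    = Real.pi * I / 4 + Real.pi * I * z / 4 by ring, Complex.exp_add, mul_assoc]
  congr 2
  refine tsum_congr fun n => ?_
  rw [jacobiTheta₂_term, jacobiTheta₂_term, Complex.exp_eq_exp_iff_exists_int]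
  obtain ⟨k, hk⟩ := Int.even_mul_succ_self n
  have hk' : ((n : ℂ)) * (n + 1) = k + k := by exact_mod_cast hk
  refine ⟨k, ?_⟩
  linear_combination (Real.pi * I) * hk'

lemma th10_add_one_pow (z : ℂ) : th10 (z + 1) ^ 4 = -th10 z ^ 4 := by
  rw [th10_add_one, mul_pow, ← Complex.exp_nat_mul,
    show ((4 : ℕ) * (Real.pi * I / 4) : ℂ) = Real.pi * I by push_cast; ring, Complex.exp_pi_mul_I]
  ring

lemma cpow_half_pow_four (w : ℂ) : (w ^ (1 / 2 : ℂ)) ^ 4 = w ^ 2 := by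
  rw [show 4 = 2 * 2 by norm_num, pow_mul, ← Complex.cpow_nat_mul]
  norm_num

/-- Fourth powers remove the branch of `(-iτ)^(1/2)`; only fourth powers of theta functions occur in
`phiI` and `phiS`. -/
lemma theta_functional (z τ : ℂ) (hτ : τ ≠ 0) : jacobiTheta₂ (z / τ) (-1 / τ) ^ 4 =
    -τ ^ 2 * (cexp (Real.pi * I * z ^ 2 / τ) * jacobiTheta₂ z τ) ^ 4 := by
  have hne : (-I * τ) ^ (1 / 2 : ℂ) ≠ 0 := by simp [hτ]
  conv_rhs => rw [jacobiTheta₂_functional_equation z τ]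
  have h1 : cexp (Real.pi * I * z ^ 2 / τ) * cexp (-Real.pi * I * z ^ 2 / τ) = 1 := by
    rw [← Complex.exp_add]; simp [neg_div]
  have h2 : ((-I * τ) ^ (1 / 2 : ℂ)) ^ 4 = -τ ^ 2 := by
    rw [cpow_half_pow_four, mul_pow]; simp
  have h3 : cexp (Real.pi * I * z ^ 2 / τ) * (1 / (-I * τ) ^ (1 / 2 : ℂ) *
      cexp (-Real.pi * I * z ^ 2 / τ) * jacobiTheta₂ (z / τ) (-1 / τ)) =
      (1 / (-I * τ) ^ (1 / 2 : ℂ)) * jacobiTheta₂ (z / τ) (-1 / τ) := by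
    linear_combination (1 / (-I * τ) ^ (1 / 2 : ℂ)) * jacobiTheta₂ (z / τ) (-1 / τ) * h1
  rw [h3, mul_pow, div_pow, h2]
  field_simp

lemma th00_inv {τ : ℂ} (hτ : τ ≠ 0) : th00 (-1 / τ) ^ 4 = -τ ^ 2 * th00 τ ^ 4 := by
  simpa [th00] using theta_functional 0 τ hτ

lemma th01_inv {τ : ℂ} (hτ : τ ≠ 0) : th01 (-1 / τ) ^ 4 = -τ ^ 2 * th10 τ ^ 4 := by
  have := theta_functional (τ / 2) τ hτ
  rw [show τ / 2 / τ = 1 / 2 by field_simp,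
    show (Real.pi * I * (τ / 2) ^ 2 / τ : ℂ) = Real.pi * I * τ / 4 by field_simp; ring] at this
  exact this

lemma th10_inv {τ : ℂ} (hτ : τ ≠ 0) : th10 (-1 / τ) ^ 4 = -τ ^ 2 * th01 τ ^ 4 := by
  have h := th01_inv (τ := -1 / τ) (by simp [hτ])
  rw [show -1 / (-1 / τ) = τ by field_simp] at h
  rw [h]
  field_simp

lemma disc_inv {z : ℂ} (hz : 0 < z.im) : disc (-1 / z) = z ^ 12 * disc z := by
  have := ModularForm.eta_comp_eq_csqrt_I_inv (x := z) hz
  simp only [Function.comp, Pi.smul_apply, Pi.mul_apply, smul_eq_mul] at this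
  have hz0 : z ≠ 0 := by rintro rfl; simp at hz
  -- The 24th power removes the square-root branch in the law for `eta`.
  have key : ∀ {w : ℂ}, w ≠ 0 → Complex.sqrt w ^ 24 = w ^ 12 := by
    intro w hw
    rw [sqrt_eq_exp hw, ← Complex.exp_nat_mul]
    rw [show ((24 : ℕ) * (log w / 2) : ℂ) = (12 : ℕ) * log w by push_cast; ring, Complex.exp_nat_mul,
      exp_log hw]
  rw [disc, this, disc, mul_pow, mul_pow, inv_pow, key I_ne_zero, key hz0,
    show I ^ 12 = 1 by rw [show 12 = 4 * 3 by norm_num, pow_mul, I_pow_four, one_pow]]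
  simp

lemma disc_add_one (z : ℂ) : disc (z + 1) = disc z := by
  have h1 : Function.Periodic.qParam 1 (z + 1) = Function.Periodic.qParam 1 z := by
    simp [Function.Periodic.qParam, mul_add, Complex.exp_add]
  have h2 : Function.Periodic.qParam 24 (z + 1) ^ 24 = Function.Periodic.qParam 24 z ^ 24 := by
    simp only [Function.Periodic.qParam, ← Complex.exp_nat_mul]
    rw [show ((24 : ℕ) * (2 * Real.pi * I * (z + 1) / (24 : ℝ)) : ℂ)
      = (24 : ℕ) * (2 * Real.pi * I * z / (24 : ℝ)) + 2 * Real.pi * I by push_cast; ring,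
      Complex.exp_add, Complex.exp_two_pi_mul_I, mul_one]
  simp only [disc, ModularForm.eta, mul_pow, h2, ModularForm.eta_q, h1]

lemma disc_ne_zero {z : ℂ} (hz : 0 < z.im) : disc z ≠ 0 :=
  pow_ne_zero _ (ModularForm.eta_ne_zero hz)

lemma differentiableAt_disc {z : ℂ} (hz : 0 < z.im) : DifferentiableAt ℂ disc z :=
  (ModularForm.differentiableAt_eta_of_mem_upperHalfPlaneSet hz).pow 24

lemma differentiableAt_th00 {z : ℂ} (hz : 0 < z.im) : DifferentiableAt ℂ th00 z :=
  differentiableAt_jacobiTheta₂_snd _ hz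

lemma differentiableAt_th01 {z : ℂ} (hz : 0 < z.im) : DifferentiableAt ℂ th01 z :=
  differentiableAt_jacobiTheta₂_snd _ hz

lemma differentiableAt_th10 {z : ℂ} (hz : 0 < z.im) : DifferentiableAt ℂ th10 z := by
  have h1 := (hasFDerivAt_jacobiTheta₂ (z / 2) hz).differentiableAt
  have h2 : DifferentiableAt ℂ (fun w : ℂ => (w / 2, w)) z := by fun_prop
  have h3 : DifferentiableAt ℂ (fun w : ℂ => jacobiTheta₂ (w / 2) w) z :=
    DifferentiableAt.comp (f := fun w : ℂ => (w / 2, w))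
      (g := fun p : ℂ × ℂ => jacobiTheta₂ p.1 p.2) z h1 h2
  exact DifferentiableAt.mul (by fun_prop) h3

lemma differentiableAt_phiI {z : ℂ} (hz : 0 < z.im) : DifferentiableAt ℂ phiI z := by
  have := differentiableAt_th01 hz
  have := differentiableAt_th10 hz
  have := differentiableAt_disc hz
  have := disc_ne_zero hz
  exact DifferentiableAt.div (by fun_prop) (by fun_prop) (by positivity)

lemma differentiableAt_phiS {z : ℂ} (hz : 0 < z.im) : DifferentiableAt ℂ phiS z := by
  have := differentiableAt_th01 hz
  have := differentiableAt_th10 hz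
  have := differentiableAt_disc hz
  have := disc_ne_zero hz
  exact DifferentiableAt.div (by fun_prop) (by fun_prop) (by positivity)

/-- The weight is `14 - 24 = -10`. Inversion exchanges `th01 ^ 4` and `th10 ^ 4` up to `-z²`; the
seventh power of that factor gives the minus sign in `phiS`. -/
lemma phiI_inv {z : ℂ} (hz : 0 < z.im) : phiI (-1 / z) = phiS z / z ^ 10 := by
  have hz0 : z ≠ 0 := by rintro rfl; simp at hz
  have h1 := th01_inv hz0
  have h2 := th10_inv hz0
  rw [phiI, phiS, disc_inv hz, show th01 (-1 / z) ^ 20 = (th01 (-1 / z) ^ 4) ^ 5 by ring,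
    show th01 (-1 / z) ^ 24 = (th01 (-1 / z) ^ 4) ^ 6 by ring,
    show th01 (-1 / z) ^ 28 = (th01 (-1 / z) ^ 4) ^ 7 by ring,
    show th10 (-1 / z) ^ 8 = (th10 (-1 / z) ^ 4) ^ 2 by ring, h1, h2]
  have := disc_ne_zero hz
  field_simp
  ring

/-! ### Growth and decay towards `i∞`. -/

lemma exists_norm_th00_sub_one_le :
    ∃ K : ℝ, 0 < K ∧ ∀ z : ℂ, 1 / 2 ≤ z.im → ‖th00 z - 1‖ ≤ K * Real.exp (-Real.pi * z.im) := by
  have h1 : Real.exp (-Real.pi * (1 / 2)) < 1 := by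
    rw [Real.exp_lt_one_iff]; nlinarith [Real.pi_pos]
  refine ⟨2 / (1 - Real.exp (-Real.pi * (1 / 2))), div_pos two_pos (by linarith), fun z hz => ?_⟩
  rw [th00, ← jacobiTheta_eq_jacobiTheta₂]
  refine (norm_jacobiTheta_sub_one_le (by linarith)).trans ?_
  have h2 : Real.exp (-Real.pi * z.im) ≤ Real.exp (-Real.pi * (1 / 2)) := by
    apply Real.exp_le_exp.mpr; nlinarith [Real.pi_pos]
  gcongr

lemma exists_norm_th01_sub_one_le :
    ∃ K : ℝ, 0 < K ∧ ∀ z : ℂ, 1 / 2 ≤ z.im → ‖th01 z - 1‖ ≤ K * Real.exp (-Real.pi * z.im) := by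
  obtain ⟨K, hK, h⟩ := exists_norm_th00_sub_one_le
  refine ⟨K, hK, fun z hz => ?_⟩
  simpa [th00_add_one] using h (z + 1) (by simpa using hz)

lemma exists_norm_th10_le :
    ∃ K : ℝ, 0 < K ∧ ∀ z : ℂ, 1 / 2 ≤ z.im →
      ‖th10 z‖ ≤ K * Real.exp (-(Real.pi / 4) * z.im) := by
  have hs : Summable fun n : ℤ => ‖jacobiTheta₂_term n (I / 2 / 2) (I / 2)‖ :=
    ((summable_jacobiTheta₂_term_iff (I / 2 / 2) (I / 2)).mpr (by simp)).norm
  refine ⟨∑' n : ℤ, ‖jacobiTheta₂_term n (I / 2 / 2) (I / 2)‖ + 1,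
    add_pos_of_nonneg_of_pos (tsum_nonneg fun _ => norm_nonneg _) one_pos, fun z hz => ?_⟩
  have h1 : ‖cexp (Real.pi * I * z / 4)‖ = Real.exp (-(Real.pi / 4) * z.im) := by
    rw [Complex.norm_exp]
    congr 1
    have : (Real.pi * I * z / 4 : ℂ) = ((Real.pi / 4 : ℝ) : ℂ) * (I * z) := by push_cast; ring
    rw [this, Complex.re_ofReal_mul]
    simp
  have h2 : ‖jacobiTheta₂ (z / 2) z‖ ≤ ∑' n : ℤ, ‖jacobiTheta₂_term n (I / 2 / 2) (I / 2)‖ := by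
    refine tsum_of_norm_bounded hs.hasSum fun n => ?_
    rw [norm_jacobiTheta₂_term, norm_jacobiTheta₂_term]
    apply Real.exp_le_exp.mpr
    -- Each term has norm `exp (-π (n² + n) Im z)`, so it is largest at the lowest allowed height,
    -- `1/2`.
    have hn : (0 : ℝ) ≤ (n : ℝ) ^ 2 + n := by
      have : (0 : ℤ) ≤ n ^ 2 + n := by nlinarith [sq_nonneg (2 * n + 1)]
      exact_mod_cast this
    have e1 : (z / 2).im = z.im / 2 := by simp
    have e2 : (I / 2 / 2).im = 1 / 4 := by norm_num
    have e3 : (I / 2).im = 1 / 2 := by norm_num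
    rw [e1, e2, e3]
    nlinarith [mul_le_mul_of_nonneg_left hz (mul_nonneg Real.pi_pos.le hn)]
  rw [th10, norm_mul, h1, mul_comm]
  gcongr
  linarith

/-- The product in `eta` is continuous and zero-free on the compact disc `|q| ≤ exp (-π)`, so it is
bounded below there; the prefactor supplies the exponential. -/
lemma exists_le_norm_disc :
    ∃ c : ℝ, 0 < c ∧ ∀ z : ℂ, 1 / 2 ≤ z.im → c * Real.exp (-(2 * Real.pi) * z.im) ≤ ‖disc z‖ := by
  set ρ := Real.exp (-Real.pi) with hρ
  have hρ1 : ρ < 1 := by rw [hρ, Real.exp_lt_one_iff]; linarith [Real.pi_pos]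
  have hsub : Metric.closedBall (0 : ℂ) ρ ⊆ Metric.ball 0 1 := Metric.closedBall_subset_ball hρ1
  have hcont := ModularForm.differentiableOn_tprod_one_sub_pow.continuousOn.mono hsub
  obtain ⟨q₀, hq₀, hmin⟩ := (isCompact_closedBall (0 : ℂ) ρ).exists_isMinOn
    ⟨0, Metric.mem_closedBall_self (Real.exp_pos _).le⟩ hcont.norm
  have hne : ∀ q ∈ Metric.closedBall (0 : ℂ) ρ, ∏' n : ℕ, (1 - q ^ (n + 1)) ≠ 0 := by
    intro q hq
    have hq1 : ‖q‖ < 1 := by simpa using hsub hq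
    simp_rw [sub_eq_add_neg]
    refine tprod_one_add_ne_zero_of_summable (f := fun n : ℕ => -q ^ (n + 1)) (fun n h => ?_) ?_
    · have h1 : q ^ (n + 1) = 1 := by linear_combination -h
      have h2 := congrArg norm h1
      rw [norm_pow, norm_one] at h2
      exact absurd h2 (pow_lt_one₀ (norm_nonneg _) hq1 (by simp)).ne
    · simpa using (summable_nat_add_iff 1).mpr (summable_geometric_of_lt_one (norm_nonneg q) hq1)
  refine ⟨‖∏' n : ℕ, (1 - q₀ ^ (n + 1))‖ ^ 24, pow_pos (norm_pos_iff.mpr (hne _ hq₀)) _,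
    fun z hz => ?_⟩
  have h1 : ‖Function.Periodic.qParam 24 z ^ 24‖ = Real.exp (-(2 * Real.pi) * z.im) := by
    rw [norm_pow, Function.Periodic.norm_qParam, ← Real.exp_nat_mul]
    congr 1
    push_cast; ring
  have h2 : Function.Periodic.qParam 1 z ∈ Metric.closedBall (0 : ℂ) ρ := by
    rw [mem_closedBall_zero_iff, Function.Periodic.norm_qParam, hρ]
    apply Real.exp_le_exp.mpr
    nlinarith [Real.pi_pos]
  rw [disc, ModularForm.eta, mul_pow, norm_mul, h1, mul_comm, norm_pow]
  gcongr
  exact hmin h2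

lemma exists_norm_phiS_le :
    ∃ C : ℝ, 0 < C ∧ ∀ z : ℂ, 1 / 2 ≤ z.im → ‖phiS z‖ ≤ C * Real.exp (-Real.pi * z.im) := by
  obtain ⟨K, hK, h01⟩ := exists_norm_th01_sub_one_le
  obtain ⟨M, hM, h10⟩ := exists_norm_th10_le
  obtain ⟨c, hc, hd⟩ := exists_le_norm_disc
  set A := K + 1
  refine ⟨(7 * M ^ 20 * A ^ 8 + 7 * M ^ 24 * A ^ 4 + 2 * M ^ 28) / c ^ 2, by positivity,
    fun z hz => ?_⟩
  -- In powers of `E` the numerator is `O(E²⁰)` and `disc²` is at least of order `E¹⁶`, which leaves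
  -- `E⁴ = exp (-π Im z)`.
  set E := Real.exp (-(Real.pi / 4) * z.im) with hE
  have hE0 : 0 < E := Real.exp_pos _
  have hE1 : E ≤ 1 := by
    rw [hE, Real.exp_le_one_iff]; nlinarith [Real.pi_pos]
  have hA : ‖th01 z‖ ≤ A := by
    have h1 : ‖th01 z‖ ≤ ‖th01 z - 1‖ + 1 := by
      simpa using norm_add_le (th01 z - 1) 1
    have h2 : Real.exp (-Real.pi * z.im) ≤ 1 := by
      rw [Real.exp_le_one_iff]; nlinarith [Real.pi_pos]
    have := h01 z hz
    nlinarith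
  have hB : ‖th10 z‖ ≤ M * E := h10 z hz
  have hD : c * E ^ 8 ≤ ‖disc z‖ := by
    convert hd z hz using 2
    rw [hE, ← Real.exp_nat_mul]; congr 1; push_cast; ring
  have hR : Real.exp (-Real.pi * z.im) = E ^ 4 := by
    rw [hE, ← Real.exp_nat_mul]; congr 1; push_cast; ring
  have hnum : ‖7 * th10 z ^ 20 * th01 z ^ 8 + 7 * th10 z ^ 24 * th01 z ^ 4 + 2 * th10 z ^ 28‖ ≤
      (7 * M ^ 20 * A ^ 8 + 7 * M ^ 24 * A ^ 4 + 2 * M ^ 28) * E ^ 20 := by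
    calc _ ≤ 7 * ‖th10 z‖ ^ 20 * ‖th01 z‖ ^ 8 + 7 * ‖th10 z‖ ^ 24 * ‖th01 z‖ ^ 4
          + 2 * ‖th10 z‖ ^ 28 := by
          refine (norm_add₃_le).trans (le_of_eq ?_)
          simp [norm_pow]
      _ ≤ 7 * (M * E) ^ 20 * A ^ 8 + 7 * (M * E) ^ 24 * A ^ 4 + 2 * (M * E) ^ 28 := by gcongr
      _ = (7 * M ^ 20 * A ^ 8) * E ^ 20 + (7 * M ^ 24 * A ^ 4) * (E ^ 20 * E ^ 4)
          + (2 * M ^ 28) * (E ^ 20 * E ^ 8) := by ring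
      _ ≤ (7 * M ^ 20 * A ^ 8) * E ^ 20 + (7 * M ^ 24 * A ^ 4) * (E ^ 20 * 1)
          + (2 * M ^ 28) * (E ^ 20 * 1) := by
          gcongr
          · exact pow_le_one₀ hE0.le hE1
          · exact pow_le_one₀ hE0.le hE1
      _ = _ := by ring
  rw [phiS, norm_div, norm_neg, norm_pow, hR]
  calc _ ≤ (7 * M ^ 20 * A ^ 8 + 7 * M ^ 24 * A ^ 4 + 2 * M ^ 28) * E ^ 20 / (c * E ^ 8) ^ 2 := by
        gcongr
    _ = _ := by field_simp

lemma exists_norm_phiI_le :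
    ∃ C : ℝ, 0 < C ∧ ∀ z : ℂ, 1 / 2 ≤ z.im → ‖phiI z‖ ≤ C * Real.exp (4 * Real.pi * z.im) := by
  obtain ⟨K, hK, h01⟩ := exists_norm_th01_sub_one_le
  obtain ⟨M, hM, h10⟩ := exists_norm_th10_le
  obtain ⟨c, hc, hd⟩ := exists_le_norm_disc
  set A := K + 1
  refine ⟨(7 * A ^ 20 * M ^ 8 + 7 * A ^ 24 * M ^ 4 + 2 * A ^ 28) / c ^ 2, by positivity,
    fun z hz => ?_⟩
  have hA : ‖th01 z‖ ≤ A := by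
    have h1 : ‖th01 z‖ ≤ ‖th01 z - 1‖ + 1 := by
      simpa using norm_add_le (th01 z - 1) 1
    have h2 : Real.exp (-Real.pi * z.im) ≤ 1 := by
      rw [Real.exp_le_one_iff]; nlinarith [Real.pi_pos]
    have := h01 z hz
    nlinarith
  have hB : ‖th10 z‖ ≤ M := by
    have h2 : Real.exp (-(Real.pi / 4) * z.im) ≤ 1 := by
      rw [Real.exp_le_one_iff]; nlinarith [Real.pi_pos]
    have := h10 z hz
    nlinarith
  have hR : Real.exp (4 * Real.pi * z.im) = 1 / Real.exp (-(2 * Real.pi) * z.im) ^ 2 := by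
    rw [← Real.exp_nat_mul, one_div, ← Real.exp_neg]; congr 1; push_cast; ring
  have hnum : ‖7 * th01 z ^ 20 * th10 z ^ 8 + 7 * th01 z ^ 24 * th10 z ^ 4 + 2 * th01 z ^ 28‖ ≤
      (7 * A ^ 20 * M ^ 8 + 7 * A ^ 24 * M ^ 4 + 2 * A ^ 28) := by
    calc _ ≤ 7 * ‖th01 z‖ ^ 20 * ‖th10 z‖ ^ 8 + 7 * ‖th01 z‖ ^ 24 * ‖th10 z‖ ^ 4
          + 2 * ‖th01 z‖ ^ 28 := by
          refine (norm_add₃_le).trans (le_of_eq ?_)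
          simp [norm_pow]
      _ ≤ _ := by gcongr
  rw [phiI, norm_div, norm_pow, hR]
  calc _ ≤ (7 * A ^ 20 * M ^ 8 + 7 * A ^ 24 * M ^ 4 + 2 * A ^ 28) /
        (c * Real.exp (-(2 * Real.pi) * z.im)) ^ 2 := by
        gcongr
        exact hd z hz
    _ = _ := by field_simp

/-! ### Jacobi's identity and the translation laws of `phiI` and `phiS`. -/

/-- The function `Θ₀₀⁴ - Θ₀₁⁴ - Θ₁₀⁴`, which vanishes by Jacobi's identity. -/
def jacobiDefect (z : ℂ) : ℂ := th00 z ^ 4 - th01 z ^ 4 - th10 z ^ 4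

/-- This sign prevents the defect itself from being modular of level one. Its square has weight 4,
where there are no nonzero cusp forms. -/
lemma jacobiDefect_add_one (z : ℂ) : jacobiDefect (z + 1) = -jacobiDefect z := by
  rw [jacobiDefect, jacobiDefect, th00_add_one, th01_add_one, th10_add_one_pow]
  ring

lemma jacobiDefect_inv {z : ℂ} (hz : z ≠ 0) :
    jacobiDefect (-1 / z) = -z ^ 2 * jacobiDefect z := by
  rw [jacobiDefect, jacobiDefect, th00_inv hz, th01_inv hz, th10_inv hz]
  ring

lemma tendsto_exp_neg_mul_im_atImInfty {a : ℝ} (ha : 0 < a) :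
    Tendsto (fun τ : ℍ => Real.exp (-a * τ.im)) atImInfty (𝓝 0) := by
  refine Real.tendsto_exp_atBot.comp ?_
  exact (tendsto_comap (f := UpperHalfPlane.im)).const_mul_atTop_of_neg (by linarith)

lemma tendsto_jacobiDefect : Tendsto (fun τ : ℍ => jacobiDefect τ) atImInfty (𝓝 0) := by
  obtain ⟨K, hK, h00⟩ := exists_norm_th00_sub_one_le
  obtain ⟨K', hK', h01⟩ := exists_norm_th01_sub_one_le
  obtain ⟨M, hM, h10⟩ := exists_norm_th10_le
  have hev : ∀ᶠ τ : ℍ in atImInfty, 1 / 2 ≤ (τ : ℂ).im :=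
    (tendsto_comap (f := UpperHalfPlane.im)).eventually_ge_atTop (1 / 2)
  have e1 := tendsto_exp_neg_mul_im_atImInfty Real.pi_pos
  have e2 := tendsto_exp_neg_mul_im_atImInfty (a := Real.pi / 4) (by linarith [Real.pi_pos])
  have t00 : Tendsto (fun τ : ℍ => th00 τ) atImInfty (𝓝 1) := by
    rw [tendsto_iff_norm_sub_tendsto_zero]
    refine squeeze_zero' (Eventually.of_forall fun _ => norm_nonneg _)
      (hev.mono fun τ hτ => h00 τ hτ) ?_
    simpa using! e1.const_mul K
  have t01 : Tendsto (fun τ : ℍ => th01 τ) atImInfty (𝓝 1) := by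
    rw [tendsto_iff_norm_sub_tendsto_zero]
    refine squeeze_zero' (Eventually.of_forall fun _ => norm_nonneg _)
      (hev.mono fun τ hτ => h01 τ hτ) ?_
    simpa using! e1.const_mul K'
  have t10 : Tendsto (fun τ : ℍ => th10 τ) atImInfty (𝓝 0) := by
    rw [tendsto_zero_iff_norm_tendsto_zero]
    refine squeeze_zero' (Eventually.of_forall fun _ => norm_nonneg _)
      (hev.mono fun τ hτ => h10 τ hτ) ?_
    simpa using! e2.const_mul M
  simpa [jacobiDefect] using! ((t00.pow 4).sub (t01.pow 4)).sub (t10.pow 4)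

open scoped MatrixGroups ModularForm in
/-- The square of the Jacobi defect is a cusp form of weight 4. -/
def jacobiDefectSq : CuspForm 𝒮ℒ 4 :=
  have hS : (fun τ : ℍ => jacobiDefect τ ^ 2) ∣[(4 : ℤ)] ModularGroup.S =
      fun τ : ℍ => jacobiDefect τ ^ 2 := by
    ext τ
    have hτ := τ.ne_zero
    rw [ModularForm.SL_slash_apply, UpperHalfPlane.modular_S_smul]
    have := jacobiDefect_inv hτ
    simp only [ModularGroup.denom_S]
    rw [← neg_inv, ← one_div, ← neg_div, this]
    rw [zpow_neg, show ((4 : ℤ)) = ((4 : ℕ) : ℤ) by rfl, zpow_natCast]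
    field_simp
  have hT : (fun τ : ℍ => jacobiDefect τ ^ 2) ∣[(4 : ℤ)] ModularGroup.T =
      fun τ : ℍ => jacobiDefect τ ^ 2 := by
    ext τ
    rw [ModularForm.SL_slash_apply, UpperHalfPlane.modular_T_smul, ModularGroup.denom_apply]
    simp [ModularGroup.T, UpperHalfPlane.coe_vadd, add_comm (1 : ℂ), jacobiDefect_add_one]
  { toFun := fun τ => jacobiDefect τ ^ 2
    slash_action_eq' := by
      rintro A ⟨A, rfl⟩
      exact SlashInvariantForm.slash_action_generators_SL2Z hS hT A
    holo' := by
      rw [UpperHalfPlane.mdifferentiable_iff]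
      have : DifferentiableOn ℂ (fun z => jacobiDefect z ^ 2) {z | 0 < z.im} := fun z hz =>
        ((((differentiableAt_th00 hz).pow 4).sub ((differentiableAt_th01 hz).pow 4)).sub
          ((differentiableAt_th10 hz).pow 4)).pow 2 |>.differentiableWithinAt
      refine this.congr fun z hz => ?_
      simp [ofComplex_apply_of_im_pos hz]
    zero_at_cusps' := by
      intro c hc
      rw [Subgroup.IsArithmetic.isCusp_iff_isCusp_SL2Z] at hc
      rw [OnePoint.isZeroAt_iff_forall_SL2Z hc]
      intro γ _
      rw [SlashInvariantForm.slash_action_generators_SL2Z hS hT]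
      simpa [IsZeroAtImInfty, ZeroAtFilter] using tendsto_jacobiDefect.pow 2 }

/-- Jacobi's identity `Θ₀₀⁴ = Θ₀₁⁴ + Θ₁₀⁴`. -/
lemma th00_pow_four {z : ℂ} (hz : 0 < z.im) : th00 z ^ 4 = th01 z ^ 4 + th10 z ^ 4 := by
  have h := rank_zero_iff_forall_zero.mp
    (CuspForm.rank_eq_zero_of_weight_lt_twelve (k := 4) (by norm_num)) jacobiDefectSq
  have h2 : jacobiDefect z ^ 2 = 0 := congrArg (fun f : CuspForm _ 4 => f ⟨z, hz⟩) h
  have h3 : jacobiDefect z = 0 := by simpa using h2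
  rw [jacobiDefect] at h3
  linear_combination h3

/-- With `a = th01⁴` and `b = th10⁴`, translation is `b ↦ -b`, `a ↦ a + b`; the coefficients 7, 7, 2
make the numerator change sign. -/
lemma phiS_add_one {z : ℂ} (hz : 0 < z.im) : phiS (z + 1) = -phiS z := by
  have h := th00_pow_four hz
  rw [phiS, phiS, disc_add_one, th01_add_one,
    show th10 (z + 1) ^ 20 = (th10 (z + 1) ^ 4) ^ 5 by ring,
    show th10 (z + 1) ^ 24 = (th10 (z + 1) ^ 4) ^ 6 by ring,
    show th10 (z + 1) ^ 28 = (th10 (z + 1) ^ 4) ^ 7 by ring,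
    show th00 z ^ 8 = (th00 z ^ 4) ^ 2 by ring, th10_add_one_pow, h]
  ring

lemma phiI_add_one {z : ℂ} (hz : 0 < z.im) : phiI (z + 1) = phiI z - phiS z := by
  have h := th00_pow_four hz
  rw [phiI, phiI, phiS, disc_add_one, th01_add_one,
    show th10 (z + 1) ^ 8 = (th10 (z + 1) ^ 4) ^ 2 by ring,
    show th00 z ^ 20 = (th00 z ^ 4) ^ 5 by ring, show th00 z ^ 24 = (th00 z ^ 4) ^ 6 by ring,
    show th00 z ^ 28 = (th00 z ^ 4) ^ 7 by ring, th10_add_one_pow, h]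
  ring

lemma phiI_sub_one {z : ℂ} (hz : 0 < z.im) : phiI (z - 1) = phiI z - phiS z := by
  have hz' : 0 < (z - 1).im := by simpa using hz
  have h1 := phiI_add_one hz'
  have h2 := phiS_add_one hz'
  rw [sub_add_cancel] at h1 h2
  rw [h1, h2]
  ring

/-! ### Schwartz functions from rapidly decreasing holomorphic functions. -/

/-- Lets Cauchy's estimates for complex derivatives bound derivatives along the real line. -/
lemma iteratedDeriv_comp_ofReal {β : ℂ → ℂ} {U : Set ℂ} (hU : IsOpen U)
    (hβ : DifferentiableOn ℂ β U) (n : ℕ) :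
    ∀ t : ℝ, (t : ℂ) ∈ U → iteratedDeriv n (fun t : ℝ => β t) t = iteratedDeriv n β t := by
  induction n with
  | zero => simp
  | succ n ih =>
    intro t ht
    have hnhds : ∀ᶠ s : ℝ in 𝓝 t, (s : ℂ) ∈ U :=
      Complex.continuous_ofReal.continuousAt.eventually (hU.mem_nhds ht)
    have hdiff : DifferentiableAt ℂ (iteratedDeriv n β) t := by
      have : DifferentiableOn ℂ (iteratedDeriv n β) U := by
        clear ih
        induction n with
        | zero => simpa using hβ
        | succ n ih' => rw [iteratedDeriv_succ]; exact ih'.deriv hU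
      exact this.differentiableAt (hU.mem_nhds ht)
    rw [iteratedDeriv_succ, iteratedDeriv_succ,
      Filter.EventuallyEq.deriv_eq (hnhds.mono fun s hs => ih s hs)]
    exact hdiff.hasDerivAt.comp_ofReal.deriv

/-- A function that is holomorphic and rapidly decreasing near the half-line `[0, ∞)` agrees there
with a Schwartz function on `ℝ`. -/
lemma exists_schwartz_of_rapidly_decreasing {β : ℂ → ℂ}
    (hβ : DifferentiableOn ℂ β {w | -(3 / 4) < w.re})
    (hdecay : ∀ k : ℕ, ∃ C : ℝ, ∀ w : ℂ, -(3 / 4) < w.re → |w.im| ≤ 1 →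
      |w.re| ^ k * ‖β w‖ ≤ C) :
    ∃ f : 𝓢(ℝ, ℂ), ∀ t : ℝ, 0 ≤ t → f t = β t := by
  have hopen : IsOpen {w : ℂ | -(3 / 4) < w.re} := isOpen_lt continuous_const Complex.continuous_re
  set χ : ℝ → ℝ := fun t => Real.smoothTransition (4 * t + 2) with hχ
  have hχ_smooth : ContDiff ℝ (↑(⊤ : ℕ∞)) χ := Real.smoothTransition.contDiff.comp (by fun_prop)
  set F : ℝ → ℂ := fun t => (χ t : ℂ) * β t with hF
  have hF0 : ∀ t : ℝ, t ≤ -(1 / 2) → F t = 0 := fun t ht => by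
    rw [hF]; simp only [hχ]
    rw [Real.smoothTransition.zero_of_nonpos (by linarith)]; simp
  have hF1 : ∀ t : ℝ, -(1 / 4) ≤ t → F t = β t := fun t ht => by
    rw [hF]; simp only [hχ]
    rw [Real.smoothTransition.one_of_one_le (by linarith)]; simp
  have hβ_real : ContDiffOn ℝ (↑(⊤ : ℕ∞)) (fun t : ℝ => β t) {t | -(3 / 4) < t} := by
    have h1 : ContDiffOn ℝ (↑(⊤ : ℕ∞)) β {w | -(3 / 4) < w.re} :=
      (hβ.contDiffOn hopen).restrict_scalars ℝ
    exact h1.comp (Complex.ofRealCLM.contDiff.contDiffOn) fun t ht => by simpa using ht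
  have hF_smooth : ContDiff ℝ (↑(⊤ : ℕ∞)) F := by
    rw [contDiff_iff_contDiffAt]
    intro t
    rcases lt_or_ge t (-(1 / 2)) with ht | ht
    · refine (contDiffAt_const (c := (0 : ℂ))).congr_of_eventuallyEq ?_
      filter_upwards [Iio_mem_nhds ht] with s hs using hF0 s (le_of_lt hs)
    · refine ContDiffAt.mul ?_ (hβ_real.contDiffAt (Ioi_mem_nhds (by linarith)))
      exact Complex.ofRealCLM.contDiff.contDiffAt.comp t hχ_smooth.contDiffAt
  have hF_decay : ∀ k n : ℕ, ∃ C : ℝ, ∀ t : ℝ, ‖t‖ ^ k * ‖iteratedFDeriv ℝ n F t‖ ≤ C := by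
    intro k n
    obtain ⟨C₀, hC₀⟩ := hdecay 0
    obtain ⟨C₁, hC₁⟩ := hdecay k
    have hcompact : ∃ C, ∀ t ∈ Set.Icc (-1 : ℝ) 0, ‖t‖ ^ k * ‖iteratedFDeriv ℝ n F t‖ ≤ C := by
      have hc : Continuous fun t : ℝ => ‖t‖ ^ k * ‖iteratedFDeriv ℝ n F t‖ :=
        (continuous_norm.pow k).mul (hF_smooth.continuous_iteratedFDeriv (by exact_mod_cast le_top)).norm
      obtain ⟨C, hC⟩ := isCompact_Icc.bddAbove_image (K := Set.Icc (-1 : ℝ) 0) hc.continuousOn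
      exact ⟨C, fun t ht => hC (Set.mem_image_of_mem _ ht)⟩
    obtain ⟨C₂, hC₂⟩ := hcompact
    refine ⟨max (max C₂ 0) (n.factorial * (2 ^ (k - 1) * (C₁ + C₀)) / (1 / 4) ^ n), fun t => ?_⟩
    rcases lt_or_ge t (-1) with ht | ht
    · have : iteratedFDeriv ℝ n F t = 0 := by
        have h0 : F =ᶠ[𝓝 t] fun _ => 0 := by
          filter_upwards [Iio_mem_nhds ht] with s hs
          exact hF0 s (by have := Set.mem_Iio.mp hs; linarith)
        have := (h0.iteratedFDeriv ℝ n).self_of_nhds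
        rw [this]
        exact congrFun (iteratedFDeriv_fun_zero (𝕜 := ℝ) (E := ℝ) (F := ℂ)) t
      rw [this]; simp
    rcases le_or_gt t 0 with ht0 | ht0
    · exact ((hC₂ t ⟨ht, ht0⟩).trans (le_max_left _ _)).trans (le_max_left _ _)
    refine le_trans ?_ (le_max_right _ _)
    have h0 : F =ᶠ[𝓝 t] fun t : ℝ => β t := by
      filter_upwards [Ioi_mem_nhds ht0] with s hs
      exact hF1 s (by have := Set.mem_Ioi.mp hs; linarith)
    rw [norm_iteratedFDeriv_eq_norm_iteratedDeriv, h0.iteratedDeriv_eq,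
      iteratedDeriv_comp_ofReal hopen hβ n t (by simp; linarith)]
    have hsub : Metric.closedBall (t : ℂ) (1 / 4) ⊆ {w | -(3 / 4) < w.re} := by
      intro w hw
      have h1 : |(w - t).re| ≤ 1 / 4 :=
        (Complex.abs_re_le_norm _).trans (by simpa [dist_eq_norm] using hw)
      have h2 := (abs_le.mp h1).1
      simp only [Complex.sub_re, Complex.ofReal_re] at h2
      simp only [Set.mem_ofPred_eq]
      linarith
    -- Cauchy's estimate is applied to `t ^ k * β` with `t` fixed. Since `|t| ≤ |Re w| + 1` on the
    -- circle, the decay bounds of orders `k` and `0` suffice.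
    have hsphere : ∀ w ∈ Metric.sphere (t : ℂ) (1 / 4),
        ‖((t : ℂ) ^ k) * β w‖ ≤ 2 ^ (k - 1) * (C₁ + C₀) := by
      intro w hw
      have hw' : ‖w - t‖ = 1 / 4 := by simpa [dist_eq_norm] using hw
      have hwU := hsub (Metric.sphere_subset_closedBall hw)
      have him : |w.im| ≤ 1 := by
        have := (Complex.abs_im_le_norm (w - t))
        simp only [Complex.sub_im, Complex.ofReal_im, sub_zero] at this
        linarith
      have hre : |t| ≤ |w.re| + 1 := by
        have h1 := Complex.abs_re_le_norm (w - t)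
        simp only [Complex.sub_re, Complex.ofReal_re] at h1
        have h2 : |t| ≤ |w.re| + |w.re - t| := by
          have := abs_sub_abs_le_abs_sub t w.re
          rw [abs_sub_comm] at this
          linarith
        linarith
      have e0 := hC₀ w hwU him
      have e1 := hC₁ w hwU him
      rw [norm_mul, norm_pow, Complex.norm_real, Real.norm_eq_abs]
      calc |t| ^ k * ‖β w‖ ≤ (|w.re| + 1) ^ k * ‖β w‖ := by gcongr
        _ ≤ (2 ^ (k - 1) * (|w.re| ^ k + 1 ^ k)) * ‖β w‖ := by
            gcongr
            exact add_pow_le (abs_nonneg _) zero_le_one k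
        _ = 2 ^ (k - 1) * (|w.re| ^ k * ‖β w‖ + |w.re| ^ 0 * ‖β w‖) := by ring
        _ ≤ _ := by gcongr
    have hcl : DiffContOnCl ℂ (fun w => (t : ℂ) ^ k * β w) (Metric.ball (t : ℂ) (1 / 4)) := by
      refine DifferentiableOn.diffContOnCl ?_
      refine ((hβ.mono ?_).const_mul _)
      exact Metric.closure_ball_subset_closedBall.trans hsub
    have := norm_iteratedDeriv_le_of_forall_mem_sphere_norm_le n (by norm_num) hcl hsphere
    rw [iteratedDeriv_const_mul_field, norm_mul, norm_pow, Complex.norm_real] at this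
    exact this
  exact ⟨⟨F, hF_smooth, hF_decay⟩, fun t ht => hF1 t (by linarith)⟩

/-- Radial version of `exists_schwartz_of_rapidly_decreasing`. -/
lemma exists_schwartz_radial {β : ℂ → ℂ}
    (hβ : DifferentiableOn ℂ β {w | -(3 / 4) < w.re})
    (hdecay : ∀ k : ℕ, ∃ C : ℝ, ∀ w : ℂ, -(3 / 4) < w.re → |w.im| ≤ 1 →
      |w.re| ^ k * ‖β w‖ ≤ C)
    (E : Type*) [NormedAddCommGroup E] [InnerProductSpace ℝ E] :
    ∃ f : 𝓢(E, ℂ), ∀ x : E, f x = β (((‖x‖ ^ 2 : ℝ)) : ℂ) := by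
  obtain ⟨f, hf⟩ := exists_schwartz_of_rapidly_decreasing hβ hdecay
  refine ⟨SchwartzMap.compCLM ℝ (g := fun x : E => ‖x‖ ^ 2)
    (Function.hasTemperateGrowth_norm_sq E) ⟨1, 1, fun x => ?_⟩ f, fun x => ?_⟩
  · rw [Real.norm_of_nonneg (by positivity)]
    nlinarith [sq_nonneg (‖x‖ - 1)]
  · exact hf (‖x‖ ^ 2) (by positivity)

/-! ### Superpositions of Gaussians and their Fourier transforms. -/

/-- A superposition of the Gaussians `exp (π i w γ(s))`, `s > c`, with amplitudes `h(s)`. -/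
def gaussSup (c : ℝ) (h γ : ℝ → ℂ) (w : ℂ) : ℂ :=
  ∫ s in Set.Ioi c, h s * cexp (Real.pi * I * w * γ s)

/-- Conditions under which `gaussSup c h γ` converges and decreases rapidly. -/
structure IsGaussSup (c : ℝ) (h γ : ℝ → ℂ) : Prop where
  half_le : 1 / 2 ≤ c
  continuousOn_amp : ContinuousOn h (Set.Ioi c)
  continuousOn_path : ContinuousOn γ (Set.Ioi c)
  exists_norm_le : ∃ C : ℝ, 0 < C ∧ ∀ s, c < s → ‖h s‖ ≤ C * Real.exp (-Real.pi * s)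
  le_im : ∀ s, c < s → 1 / (2 * s) ≤ (γ s).im
  im_le : ∀ s, c < s → (γ s).im ≤ s + 1
  abs_re_le : ∀ s, c < s → |(γ s).re| ≤ 1

lemma norm_cexp_pi_I_mul (w z : ℂ) : ‖cexp (Real.pi * I * w * z)‖ =
    Real.exp (-Real.pi * (w.re * z.im + w.im * z.re)) := by
  rw [Complex.norm_exp]
  congr 1
  rw [show (Real.pi * I * w * z : ℂ) = (Real.pi : ℂ) * (I * (w * z)) by ring, Complex.re_ofReal_mul]
  simp
  ring

lemma pow_le_factorial_mul_exp {x : ℝ} (hx : 0 ≤ x) (n : ℕ) :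
    x ^ n ≤ n.factorial * Real.exp x := by
  have := Real.pow_div_factorial_le_exp x hx n
  rwa [div_le_iff₀' (by positivity)] at this

namespace IsGaussSup

variable {c : ℝ} {h γ : ℝ → ℂ}

/-- For `Re w ≥ 0`, `Im γ ≥ 1/(2s)` gives a factor at most `exp (-Re w / s)`, which absorbs `(Re w /
s) ^ k` at the price of `s ^ k`. For `-3/4 < Re w < 0` the Gaussian grows at most like `exp (3π(s +
1)/4)`. Against the amplitude's `exp (-πs)`, decay `exp (-πs/4)` survives in both cases. -/
lemma exists_integrand_bound (H : IsGaussSup c h γ) (k : ℕ) : ∃ C : ℝ, 0 < C ∧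
    ∀ (M : ℝ) (w : ℂ) (s : ℝ), c < s → -(3 / 4) < w.re → |w.im| ≤ M →
      |w.re| ^ k * ‖h s * cexp (Real.pi * I * w * γ s)‖ ≤
        C * Real.exp (Real.pi * M) * Real.exp (-(Real.pi / 4) * s) := by
  obtain ⟨C, hC, hb⟩ := H.exists_norm_le
  have hπ := Real.pi_gt_three
  refine ⟨C * (k.factorial ^ 2 * Real.exp Real.pi), by positivity, fun M w s hs hw hM => ?_⟩
  have hs0 : 1 / 2 < s := H.half_le.trans_lt hs
  have him0 : 0 < (γ s).im := lt_of_lt_of_le (by positivity) (H.le_im s hs)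
  have hre : -(w.im * (γ s).re) ≤ M := by
    have h1 : |w.im * (γ s).re| ≤ M * 1 := by
      rw [abs_mul]
      exact mul_le_mul hM (H.abs_re_le s hs) (abs_nonneg _) ((abs_nonneg _).trans hM)
    have := (abs_le.mp h1).1
    linarith
  have hfac : (1 : ℝ) ≤ (k.factorial : ℝ) ^ 2 :=
    one_le_pow₀ (by exact_mod_cast k.factorial_pos)
  have key : |w.re| ^ k * Real.exp (-Real.pi * (w.re * (γ s).im)) ≤
      k.factorial ^ 2 * Real.exp (Real.pi + 3 / 4 * Real.pi * s) := by
    rcases le_or_gt 0 w.re with h0 | h0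
    · have h1 : (w.re / s) ^ k ≤ k.factorial * Real.exp (w.re / s) :=
        pow_le_factorial_mul_exp (by positivity) k
      have h2 : s ^ k ≤ k.factorial * Real.exp s := pow_le_factorial_mul_exp (by linarith) k
      have h3 : w.re / s ≤ Real.pi * (w.re * (γ s).im) := by
        have h4 := mul_le_mul_of_nonneg_left (H.le_im s hs) h0
        have h5 : w.re / s = 2 * (w.re * (1 / (2 * s))) := by field_simp
        have h6 : 0 ≤ w.re * (γ s).im := mul_nonneg h0 him0.le
        nlinarith
      calc |w.re| ^ k * Real.exp (-Real.pi * (w.re * (γ s).im))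
          = (w.re / s) ^ k * s ^ k * Real.exp (-Real.pi * (w.re * (γ s).im)) := by
            rw [abs_of_nonneg h0, ← mul_pow, div_mul_cancel₀ _ (by linarith : s ≠ 0)]
        _ ≤ (k.factorial * Real.exp (w.re / s)) * (k.factorial * Real.exp s) *
              Real.exp (-(w.re / s)) := by
            gcongr
            linarith
        _ = k.factorial ^ 2 * Real.exp s := by
            rw [Real.exp_neg]; field_simp
        _ ≤ _ := by
            gcongr
            nlinarith
    · have h1 : |w.re| ^ k ≤ 1 := pow_le_one₀ (abs_nonneg _) (by rw [abs_of_neg h0]; linarith)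
      have h2 : -Real.pi * (w.re * (γ s).im) ≤ Real.pi + 3 / 4 * Real.pi * s := by
        have h3 : -w.re * (γ s).im ≤ 3 / 4 * (s + 1) := by
          have := H.im_le s hs
          nlinarith
        nlinarith
      calc _ ≤ 1 * Real.exp (Real.pi + 3 / 4 * Real.pi * s) := by gcongr
        _ ≤ _ := by gcongr
  rw [norm_mul, norm_cexp_pi_I_mul,
    show -Real.pi * (w.re * (γ s).im + w.im * (γ s).re) =
      -Real.pi * (w.re * (γ s).im) + Real.pi * -(w.im * (γ s).re) by ring, Real.exp_add]
  calc |w.re| ^ k * (‖h s‖ * (Real.exp (-Real.pi * (w.re * (γ s).im)) *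
        Real.exp (Real.pi * -(w.im * (γ s).re))))
      = ‖h s‖ * (|w.re| ^ k * Real.exp (-Real.pi * (w.re * (γ s).im))) *
        Real.exp (Real.pi * -(w.im * (γ s).re)) := by ring
    _ ≤ (C * Real.exp (-Real.pi * s)) *
        (k.factorial ^ 2 * Real.exp (Real.pi + 3 / 4 * Real.pi * s)) *
        Real.exp (Real.pi * M) := by
        gcongr
        exact hb s hs
    _ = C * (k.factorial ^ 2 * Real.exp Real.pi) * Real.exp (Real.pi * M) *
        (Real.exp (-Real.pi * s) * Real.exp (3 / 4 * Real.pi * s)) := by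
        rw [Real.exp_add]; ring
    _ = _ := by
        rw [← Real.exp_add]; ring_nf

lemma aestronglyMeasurable (H : IsGaussSup c h γ) (w : ℂ) :
    AEStronglyMeasurable (fun s => h s * cexp (Real.pi * I * w * γ s))
      (volume.restrict (Set.Ioi c)) := by
  refine ContinuousOn.aestronglyMeasurable ?_ measurableSet_Ioi
  exact H.continuousOn_amp.mul (H.continuousOn_path.const_mul _).cexp

lemma integrableOn_exp {a c : ℝ} (ha : 0 < a) (K : ℝ) :
    IntegrableOn (fun s : ℝ => K * Real.exp (-a * s)) (Set.Ioi c) :=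
  (integrableOn_exp_mul_Ioi (by linarith) c).const_mul K

lemma integrableOn (H : IsGaussSup c h γ) {w : ℂ} (hw : -(3 / 4) < w.re) :
    IntegrableOn (fun s => h s * cexp (Real.pi * I * w * γ s)) (Set.Ioi c) := by
  obtain ⟨C, hC, hb⟩ := H.exists_integrand_bound 0
  refine Integrable.mono' (integrableOn_exp (a := Real.pi / 4) (by positivity)
    (C * Real.exp (Real.pi * |w.im|))) (H.aestronglyMeasurable w) ?_
  filter_upwards [ae_restrict_mem measurableSet_Ioi] with s hs
  simpa using hb |w.im| w s hs hw le_rfl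

lemma rapidly_decreasing (H : IsGaussSup c h γ) (k : ℕ) : ∃ C : ℝ, ∀ w : ℂ,
    -(3 / 4) < w.re → |w.im| ≤ 1 → |w.re| ^ k * ‖gaussSup c h γ w‖ ≤ C := by
  obtain ⟨C, hC, hb⟩ := H.exists_integrand_bound k
  refine ⟨∫ s in Set.Ioi c, C * Real.exp (Real.pi * 1) * Real.exp (-(Real.pi / 4) * s),
    fun w hw him => ?_⟩
  have : |w.re| ^ k * ‖gaussSup c h γ w‖ =
      ‖∫ s in Set.Ioi c, ((|w.re| ^ k : ℝ) : ℂ) * (h s * cexp (Real.pi * I * w * γ s))‖ := by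
    rw [integral_const_mul, norm_mul, gaussSup, Complex.norm_real, Real.norm_of_nonneg (by positivity)]
  rw [this]
  refine norm_integral_le_of_norm_le (integrableOn_exp (by positivity) _) ?_
  filter_upwards [ae_restrict_mem measurableSet_Ioi] with s hs
  rw [norm_mul, Complex.norm_real, Real.norm_of_nonneg (by positivity)]
  exact hb 1 w s hs hw him

lemma differentiableOn (H : IsGaussSup c h γ) :
    DifferentiableOn ℂ (gaussSup c h γ) {w | -(3 / 4) < w.re} := by
  intro w₀ hw₀
  obtain ⟨C, hC, hb⟩ := H.exists_integrand_bound 0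
  have hopen : IsOpen {w : ℂ | -(3 / 4) < w.re ∧ |w.im| < |w₀.im| + 1} :=
    (isOpen_lt continuous_const Complex.continuous_re).inter
      (isOpen_lt Complex.continuous_im.abs continuous_const)
  have hmeas : ∀ w, AEStronglyMeasurable
      (fun s => h s * cexp (Real.pi * I * w * γ s) * (Real.pi * I * γ s))
      (volume.restrict (Set.Ioi c)) := fun w =>
    (H.aestronglyMeasurable w).mul
      ((H.continuousOn_path.const_mul _).aestronglyMeasurable measurableSet_Ioi)
  have hπ := Real.pi_gt_three
  refine (hasDerivAt_integral_of_dominated_loc_of_deriv_le (μ := volume.restrict (Set.Ioi c))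
    (F := fun w s => h s * cexp (Real.pi * I * w * γ s))
    (F' := fun w s => h s * cexp (Real.pi * I * w * γ s) * (Real.pi * I * γ s))
    (bound := fun s => C * Real.exp (Real.pi * (|w₀.im| + 1)) * 16 *
      Real.exp (-(Real.pi / 8) * s))
    (hopen.mem_nhds ⟨hw₀, by linarith⟩) (Eventually.of_forall H.aestronglyMeasurable)
    (H.integrableOn hw₀) (hmeas w₀) ?_ (integrableOn_exp (by positivity) _)
    ?_).2.differentiableAt.differentiableWithinAt
  · filter_upwards [ae_restrict_mem measurableSet_Ioi] with s hs w hw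
    have h1 := hb (|w₀.im| + 1) w s hs hw.1 hw.2.le
    rw [pow_zero, one_mul] at h1
    have hs0 : 1 / 2 < s := H.half_le.trans_lt hs
    have him0 : 0 < (γ s).im := lt_of_lt_of_le (by positivity) (H.le_im s hs)
    -- Differentiation brings down `γ s`, of size at most `s + 2`; half of the remaining decay pays
    -- for it.
    have h2 : ‖(Real.pi * I * γ s : ℂ)‖ ≤ 16 * Real.exp (Real.pi / 8 * s) := by
      have e1 : ‖γ s‖ ≤ s + 2 := by
        have := Complex.norm_le_abs_re_add_abs_im (γ s)
        have := H.abs_re_le s hs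
        have := H.im_le s hs
        rw [abs_of_pos him0] at *
        linarith
      have e2 : Real.pi / 8 * s + 1 ≤ Real.exp (Real.pi / 8 * s) := Real.add_one_le_exp _
      have e3 := Real.pi_lt_four
      rw [norm_mul, norm_mul, Complex.norm_I, mul_one, Complex.norm_real,
        Real.norm_of_nonneg Real.pi_pos.le]
      nlinarith
    rw [norm_mul]
    calc _ ≤ (C * Real.exp (Real.pi * (|w₀.im| + 1)) * Real.exp (-(Real.pi / 4) * s)) *
          (16 * Real.exp (Real.pi / 8 * s)) := by gcongr
      _ = C * Real.exp (Real.pi * (|w₀.im| + 1)) * 16 *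
          (Real.exp (-(Real.pi / 4) * s) * Real.exp (Real.pi / 8 * s)) := by ring
      _ = _ := by rw [← Real.exp_add]; ring_nf
  · filter_upwards with s w _
    have h1 : HasDerivAt (fun w : ℂ => Real.pi * I * w * γ s) (Real.pi * I * γ s) w := by
      simpa using ((hasDerivAt_id w).const_mul (Real.pi * I : ℂ)).mul_const (γ s)
    simpa [mul_assoc] using h1.cexp.const_mul (h s)

lemma exists_schwartz (H : IsGaussSup c h γ) (E : Type*) [NormedAddCommGroup E]
    [InnerProductSpace ℝ E] :
    ∃ f : 𝓢(E, ℂ), ∀ x : E, f x = gaussSup c h γ (((‖x‖ ^ 2 : ℝ)) : ℂ) :=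
  exists_schwartz_radial H.differentiableOn H.rapidly_decreasing E

/-- The Fourier transform of a superposition of Gaussians in dimension 24. -/
lemma fourier_eq (H : IsGaussSup c h γ) {E : Type*} [NormedAddCommGroup E]
    [InnerProductSpace ℝ E] [FiniteDimensional ℝ E] [MeasurableSpace E] [BorelSpace E]
    (hE : Module.finrank ℝ E = 24) (y : E) :
    𝓕 (fun x : E => gaussSup c h γ (((‖x‖ ^ 2 : ℝ)) : ℂ)) y =
      gaussSup c (fun s => h s / γ s ^ 12) (fun s => -1 / γ s) (((‖y‖ ^ 2 : ℝ)) : ℂ) := by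
  have him : ∀ s, c < s → 0 < (γ s).im := fun s hs =>
    lt_of_lt_of_le (by have := H.half_le; have : 0 < s := by linarith
                       positivity) (H.le_im s hs)
  set G : E → ℝ → ℂ := fun x s => cexp (↑(-2 * Real.pi * inner ℝ x y) * I) *
    (h s * cexp (Real.pi * I * ((‖x‖ ^ 2 : ℝ) : ℂ) * γ s)) with hG
  have hnorm : ∀ x s, ‖G x s‖ = ‖h s‖ * Real.exp (-(Real.pi * (γ s).im) * ‖x‖ ^ 2) := by
    intro x s
    rw [hG]
    simp only
    rw [norm_mul, Complex.norm_exp_ofReal_mul_I, one_mul, norm_mul, norm_cexp_pi_I_mul,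
      Complex.ofReal_re, Complex.ofReal_im]
    congr 2
    ring
  have hmeas : AEStronglyMeasurable (Function.uncurry G)
      ((volume : Measure E).prod (volume.restrict (Set.Ioi c))) := by
    have m1 : AEStronglyMeasurable (fun p : E × ℝ => h p.2)
        ((volume : Measure E).prod (volume.restrict (Set.Ioi c))) :=
      (H.continuousOn_amp.aestronglyMeasurable measurableSet_Ioi).comp_snd
    have m2 : AEStronglyMeasurable (fun p : E × ℝ => γ p.2)
        ((volume : Measure E).prod (volume.restrict (Set.Ioi c))) :=
      (H.continuousOn_path.aestronglyMeasurable measurableSet_Ioi).comp_snd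
    have m3 : Continuous fun p : E × ℝ => cexp (↑(-2 * Real.pi * inner ℝ p.1 y) * I) := by fun_prop
    have m4 : Continuous fun p : E × ℝ => (Real.pi * I * ((‖p.1‖ ^ 2 : ℝ) : ℂ) : ℂ) := by fun_prop
    exact m3.aestronglyMeasurable.mul (m1.mul
      (Complex.continuous_exp.comp_aestronglyMeasurable (m4.aestronglyMeasurable.mul m2)))
  have hint : Integrable (Function.uncurry G)
      ((volume : Measure E).prod (volume.restrict (Set.Ioi c))) := by
    rw [integrable_prod_iff' hmeas]
    constructor
    · filter_upwards [ae_restrict_mem measurableSet_Ioi] with s hs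
      have hm : AEStronglyMeasurable (fun x : E => G x s) volume := by
        apply Continuous.aestronglyMeasurable
        simp only [hG]
        fun_prop
      refine (integrable_norm_iff hm).mp ?_
      simp only [hnorm]
      refine Integrable.const_mul ?_ _
      have := (GaussianFourier.integrable_cexp_neg_mul_sq_norm_add (V := E)
        (b := ((Real.pi * (γ s).im : ℝ) : ℂ))
        (by rw [Complex.ofReal_re]; exact mul_pos Real.pi_pos (him s hs)) 0 0).norm
      refine this.congr (Eventually.of_forall fun x => ?_)
      simp only [Complex.norm_exp, zero_mul, add_zero]
      congr 1
      rw [show (-((Real.pi * (γ s).im : ℝ) : ℂ) * (‖x‖ : ℂ) ^ 2) =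
        ((-(Real.pi * (γ s).im) * ‖x‖ ^ 2 : ℝ) : ℂ) by push_cast; ring, Complex.ofReal_re]
    · obtain ⟨C, hC, hb⟩ := H.exists_norm_le
      have hval : ∀ s ∈ Set.Ioi c, ∫ x : E, ‖Function.uncurry G (x, s)‖ =
          ‖h s‖ * (1 / (γ s).im) ^ 12 := by
        intro s hs
        have := him s hs
        simp only [Function.uncurry, hnorm]
        rw [integral_const_mul, GaussianFourier.integral_rexp_neg_mul_sq_norm (by positivity)]
        congr 1
        rw [hE, show (Real.pi / (Real.pi * (γ s).im)) = 1 / (γ s).im by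
          field_simp, show (((24 : ℕ) : ℝ) / 2) = ((12 : ℕ) : ℝ) by norm_num, Real.rpow_natCast]
      -- The Gaussian integral over `E` is `(1 / Im γ)¹² ≤ (2s)¹²`. Bounding `s¹²` by `12! exp s`
      -- leaves `exp (-(π - 1)s) ≤ exp (-2s)`, which justifies Fubini.
      refine Integrable.mono' (integrableOn_exp (a := 2) two_pos
        (C * ((2 : ℝ) ^ 12 * (Nat.factorial 12 : ℝ)))) ?_ ?_
      · exact hmeas.norm.prod_swap.integral_prod_right'
      · filter_upwards [ae_restrict_mem measurableSet_Ioi] with s hs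
        have hs0 : 0 < s := by have := H.half_le; have := Set.mem_Ioi.mp hs; linarith
        have hims := him s hs
        rw [hval s hs, Real.norm_of_nonneg (by positivity)]
        have h1 : 1 / (γ s).im ≤ 2 * s := by
          have := H.le_im s hs
          rw [div_le_iff₀ hims]
          rw [div_le_iff₀ (by positivity)] at this
          linarith
        calc ‖h s‖ * (1 / (γ s).im) ^ 12 ≤ (C * Real.exp (-Real.pi * s)) * (2 * s) ^ 12 := by
              gcongr
              exact hb s hs
          _ = (C * Real.exp (-Real.pi * s)) * (2 ^ 12 * s ^ 12) := by rw [mul_pow]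
          _ ≤ (C * Real.exp (-Real.pi * s)) * ((2 : ℝ) ^ 12 * ((Nat.factorial 12 : ℝ) * Real.exp s)) := by
              gcongr
              exact pow_le_factorial_mul_exp hs0.le 12
          _ = (C * ((2 : ℝ) ^ 12 * (Nat.factorial 12 : ℝ))) * (Real.exp (-Real.pi * s) * Real.exp s) := by ring
          _ ≤ (C * ((2 : ℝ) ^ 12 * (Nat.factorial 12 : ℝ))) * Real.exp (-2 * s) := by
              rw [← Real.exp_add]
              refine mul_le_mul_of_nonneg_left (Real.exp_le_exp.mpr ?_) (by positivity)
              nlinarith [Real.pi_gt_three]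
  rw [Real.fourier_eq']
  have e1 : ∀ x : E, cexp (↑(-2 * Real.pi * inner ℝ x y) * I) •
      gaussSup c h γ (((‖x‖ ^ 2 : ℝ)) : ℂ) = ∫ s in Set.Ioi c, G x s := by
    intro x
    rw [smul_eq_mul, gaussSup, ← integral_const_mul]
  simp_rw [e1]
  rw [integral_integral_swap hint, gaussSup]
  refine setIntegral_congr_fun measurableSet_Ioi fun s hs => ?_
  have hims := him s hs
  have hγ : γ s ≠ 0 := fun h0 => by rw [h0] at hims; simp at hims
  have hgauss := fourier_gaussian_innerProductSpace (V := E) (b := -(Real.pi * I * γ s))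
    (by simpa [Complex.mul_re] using mul_pos Real.pi_pos hims) y
  rw [Real.fourier_eq'] at hgauss
  have e2 : ∫ x : E, G x s = h s * ∫ x : E, cexp (↑(-2 * Real.pi * inner ℝ x y) * I) •
      cexp (-(-(Real.pi * I * γ s)) * (‖x‖ : ℂ) ^ 2) := by
    rw [← integral_const_mul]
    refine integral_congr_ae (Eventually.of_forall fun x => ?_)
    simp only [hG, smul_eq_mul]
    rw [show (Real.pi * I * ((‖x‖ ^ 2 : ℝ) : ℂ) * γ s : ℂ) =
      -(-(Real.pi * I * γ s)) * (‖x‖ : ℂ) ^ 2 by push_cast; ring]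
    ring
  rw [e2, hgauss, hE,
    show (((24 : ℕ) : ℂ) / 2) = ((12 : ℕ) : ℂ) by norm_num, Complex.cpow_natCast]
  have hπ : (Real.pi : ℂ) ≠ 0 := by exact_mod_cast Real.pi_ne_zero
  -- Dimension 24 enters here: the exponent is `24 / 2 = 12`, and `i¹² = 1`.
  have e3 : ((Real.pi : ℂ) / -(Real.pi * I * γ s)) ^ 12 = 1 / γ s ^ 12 := by
    rw [show ((Real.pi : ℂ) / -(Real.pi * I * γ s)) = I / γ s by
      field_simp; simp, div_pow, show I ^ 12 = 1 by
      rw [show 12 = 4 * 3 by norm_num, pow_mul, I_pow_four, one_pow]]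
  have e4 : (-(Real.pi : ℂ) ^ 2 * (‖y‖ : ℂ) ^ 2 / -(Real.pi * I * γ s)) =
      Real.pi * I * ((‖y‖ ^ 2 : ℝ) : ℂ) * (-1 / γ s) := by
    push_cast
    field_simp
    simp
  rw [e3, e4]
  ring

end IsGaussSup

/-! ### Tools for contour integration. -/

/-- A holomorphic function on the upper half plane has a primitive. -/
lemma exists_primitive_upperHalfPlane {f : ℂ → ℂ} (hf : ∀ z : ℂ, 0 < z.im → DifferentiableAt ℂ f z) :
    ∃ F : ℂ → ℂ, ∀ z : ℂ, 0 < z.im → HasDerivAt F (f z) z := by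
  -- The Cayley transform carries the problem to the unit disc, where holomorphic functions have
  -- primitives.
  have him : ∀ w ∈ Metric.ball (0 : ℂ) 1, 0 < (I * (1 + w) / (1 - w)).im := by
    intro w hw
    have hw1 : ‖w‖ < 1 := by simpa using hw
    have hne : 1 - w ≠ 0 := fun h => by
      rw [← sub_eq_zero.mp h] at hw1; simp at hw1
    have hsq : w.re ^ 2 + w.im ^ 2 < 1 := by
      rw [show w.re ^ 2 + w.im ^ 2 = ‖w‖ ^ 2 by rw [Complex.sq_norm, Complex.normSq_apply]; ring]
      nlinarith [norm_nonneg w]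
    rw [Complex.div_im, ← sub_div]
    refine div_pos ?_ (Complex.normSq_pos.mpr hne)
    simp
    nlinarith
  have hne : ∀ w ∈ Metric.ball (0 : ℂ) 1, 1 - w ≠ 0 := by
    intro w hw h
    have hw1 : ‖w‖ < 1 := by simpa using hw
    rw [← sub_eq_zero.mp h] at hw1; simp at hw1
  have hg : DifferentiableOn ℂ (fun w => f (I * (1 + w) / (1 - w)) * (2 * I / (1 - w) ^ 2))
      (Metric.ball 0 1) := by
    intro w hw
    have h1 := hf _ (him w hw)
    have h2 := hne w hw
    have h3 : DifferentiableAt ℂ (fun w : ℂ => I * (1 + w) / (1 - w)) w :=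
      DifferentiableAt.div (by fun_prop) (by fun_prop) h2
    have h4 : DifferentiableAt ℂ (fun w : ℂ => 2 * I / (1 - w) ^ 2) w :=
      DifferentiableAt.div (by fun_prop) (by fun_prop) (pow_ne_zero 2 h2)
    exact ((DifferentiableAt.comp w (g := f) h1 h3).mul h4).differentiableWithinAt
  obtain ⟨G, hG⟩ := hg.isExactOn_ball
  refine ⟨fun z => G ((z - I) / (z + I)), fun z hz => ?_⟩
  have hzI : z + I ≠ 0 := fun h => by
    have := congrArg Complex.im h
    simp at this
    linarith
  have hball : (z - I) / (z + I) ∈ Metric.ball (0 : ℂ) 1 := by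
    rw [mem_ball_zero_iff, norm_div, div_lt_one (norm_pos_iff.mpr hzI)]
    refine lt_of_pow_lt_pow_left₀ 2 (norm_nonneg _) ?_
    rw [Complex.sq_norm, Complex.sq_norm, Complex.normSq_apply, Complex.normSq_apply]
    simp
    nlinarith
  have h1 : HasDerivAt (fun z : ℂ => (z - I) / (z + I))
      ((1 * (z + I) - (z - I) * 1) / (z + I) ^ 2) z :=
    ((hasDerivAt_id z).sub_const I).div ((hasDerivAt_id z).add_const I) hzI
  have h2 := HasDerivAt.comp z (hG _ hball) h1
  have e1 : 1 - (z - I) / (z + I) = 2 * I / (z + I) := by field_simp; ring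
  have e2 : I * (1 + (z - I) / (z + I)) / (1 - (z - I) / (z + I)) = z := by
    rw [e1]
    field_simp
    ring
  refine h2.congr_deriv ?_
  simp only
  rw [e2, e1]
  field_simp
  ring

/-- Integrability of the derivative alone forces the limit to exist. Its value is never needed, only
that limits along neighbouring lines agree. -/
lemma exists_integral_Ioi_eq {f f' : ℝ → ℂ} {a : ℝ}
    (hderiv : ∀ x ∈ Set.Ici a, HasDerivAt f (f' x) x) (hint : IntegrableOn f' (Set.Ioi a)) :
    ∃ m, Tendsto f atTop (𝓝 m) ∧ ∫ x in Set.Ioi a, f' x = m - f a := by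
  have := tendsto_limUnder_of_hasDerivAt_of_integrableOn_Ioi
    (fun x hx => hderiv x (Set.Ioi_subset_Ici_self hx)) hint
  exact ⟨_, this, integral_Ioi_of_hasDerivAt_of_tendsto' hderiv hint this⟩

/-- The mean value inequality on the horizontal segment at height `t`: this closes the contour at
infinity. -/
lemma tendsto_sub_horizontal {F f : ℂ → ℂ} {η : ℝ → ℝ}
    (hF : ∀ z : ℂ, 0 < z.im → HasDerivAt F (f z) z)
    (hf : ∀ z : ℂ, 1 ≤ z.im → ‖f z‖ ≤ η z.im) (hη : Tendsto η atTop (𝓝 0)) (a b : ℝ) :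
    Tendsto (fun t : ℝ => F (a + I * t) - F (b + I * t)) atTop (𝓝 0) := by
  rw [tendsto_zero_iff_norm_tendsto_zero]
  refine squeeze_zero' (Eventually.of_forall fun _ => norm_nonneg _) ?_
    (by simpa using hη.mul_const |a - b|)
  filter_upwards [eventually_ge_atTop (1 : ℝ)] with t ht
  have hconv : Convex ℝ ({z : ℂ | z.im ≤ t} ∩ {z : ℂ | t ≤ z.im}) :=
    (convex_halfSpace_im_le t).inter (convex_halfSpace_im_ge t)
  have key := hconv.norm_image_sub_le_of_norm_hasDerivWithin_le (f := F) (f' := f) (C := η t)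
    (x := b + I * t) (y := a + I * t)
    (fun z hz => (hF z (by have : t ≤ z.im := hz.2; linarith)).hasDerivWithinAt)
    (fun z hz => by
      have h1 : z.im = t := le_antisymm hz.1 hz.2
      rw [← h1]
      exact hf z (by rw [h1]; exact ht))
    ⟨by simp, by simp⟩ ⟨by simp, by simp⟩
  have e : ‖((a : ℂ) + I * t) - (b + I * t)‖ = |a - b| := by
    rw [show ((a : ℂ) + I * t) - (b + I * t) = ((a - b : ℝ) : ℂ) by push_cast; ring,
      Complex.norm_real, Real.norm_eq_abs]
  rwa [e] at key

lemma integral_Ioi_zero_eq_add {G : ℝ → ℂ} (h1 : IntegrableOn G (Set.Ioi 1))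
    (h2 : IntegrableOn (fun s : ℝ => ((1 / s ^ 2 : ℝ) : ℂ) * G (1 / s)) (Set.Ioi 1)) :
    IntegrableOn G (Set.Ioi 0) ∧ ∫ t in Set.Ioi 0, G t =
      (∫ t in Set.Ioi 1, G t) + ∫ s in Set.Ioi 1, ((1 / s ^ 2 : ℝ) : ℂ) * G (1 / s) := by
  have himage : (fun s : ℝ => 1 / s) '' Set.Ioi 1 = Set.Ioo 0 1 := by
    ext t
    constructor
    · rintro ⟨s, hs, rfl⟩
      have hs : 1 < s := hs
      exact ⟨by positivity, by rw [div_lt_one (by linarith)]; exact hs⟩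
    · rintro ⟨h0, h1⟩
      exact ⟨1 / t, by rw [Set.mem_Ioi, lt_div_iff₀ h0]; linarith, by simp⟩
  have hderiv : ∀ s ∈ Set.Ioi (1 : ℝ), HasDerivWithinAt (fun s : ℝ => 1 / s) (-(1 / s ^ 2))
      (Set.Ioi 1) s := by
    intro s hs
    have hs : 1 < s := hs
    simpa [one_div] using (hasDerivAt_inv (by linarith : s ≠ 0)).hasDerivWithinAt
  have hinj : Set.InjOn (fun s : ℝ => 1 / s) (Set.Ioi 1) := by
    intro x _ y _ hxy
    simpa using hxy
  have hfun : (fun s : ℝ => |(-(1 / s ^ 2))| • G (1 / s)) =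
      fun s : ℝ => ((1 / s ^ 2 : ℝ) : ℂ) * G (1 / s) := by
    ext s
    rw [abs_neg, abs_of_nonneg (by positivity), Complex.real_smul]
  have hi := integrableOn_image_iff_integrableOn_abs_deriv_smul measurableSet_Ioi hderiv hinj G
  have hv := integral_image_eq_integral_abs_deriv_smul measurableSet_Ioi hderiv hinj G
  rw [himage, hfun] at hi hv
  have h3 : IntegrableOn G (Set.Ioc 0 1) := (integrableOn_Ioc_iff_integrableOn_Ioo (a := (0 : ℝ))).mpr (hi.mpr h2)
  rw [← Set.Ioc_union_Ioi_eq_Ioi (zero_le_one (α := ℝ))]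
  refine ⟨h3.union h1, ?_⟩
  rw [setIntegral_union Set.Ioc_disjoint_Ioi_same measurableSet_Ioi h3 h1, add_comm,
    integral_Ioc_eq_integral_Ioo, hv]

/-! ### The four contour pieces. -/

/-- The point `σ / 2 + i s`. -/
def arcBase (σ s : ℝ) : ℂ := σ / 2 + I * s

/-- The unit circle arc from `i` to `σ = ±1`, parametrized by `s ≥ 1/2`. -/
def arcPath (σ s : ℝ) : ℂ := σ - 1 / arcBase σ s

/-- The amplitude belonging to `arcPath`. -/
def arcAmp (σ s : ℝ) : ℂ := -I * phiS (arcBase σ s) / arcBase σ s ^ 12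

/-- The segment from `i` to `0`, parametrized by `s ≥ 1`. -/
def cuspPath (s : ℝ) : ℂ := I / s

/-- The amplitude belonging to `cuspPath`. -/
def cuspAmp (s : ℝ) : ℂ := 2 * I * phiS (I * s) / s ^ 12

/-- The half-line from `i` to `i∞`, parametrized by `s ≥ 1`. -/
def topPath (s : ℝ) : ℂ := I * s

/-- The amplitude belonging to `topPath`. -/
def topAmp (s : ℝ) : ℂ := -2 * I * phiS (I * s)

lemma arcBase_im (σ s : ℝ) : (arcBase σ s).im = s := by
  rw [arcBase, show ((σ : ℂ) / 2) = ((σ / 2 : ℝ) : ℂ) by push_cast; rfl]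
  simp

lemma arcBase_re (σ s : ℝ) : (arcBase σ s).re = σ / 2 := by
  rw [arcBase, show ((σ : ℂ) / 2) = ((σ / 2 : ℝ) : ℂ) by push_cast; rfl]
  simp

lemma ne_zero_of_im_pos {z : ℂ} (hz : 0 < z.im) : z ≠ 0 := by
  rintro rfl; simp at hz

lemma arcPath_im {σ : ℝ} (hσ : σ ^ 2 = 1) (s : ℝ) : (arcPath σ s).im = s / (1 / 4 + s ^ 2) := by
  have : Complex.normSq (arcBase σ s) = 1 / 4 + s ^ 2 := by
    rw [Complex.normSq_apply, arcBase_im, arcBase_re]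
    linear_combination hσ / 4
  simp [arcPath, Complex.inv_im, this, arcBase_im, neg_div]

lemma arcPath_re {σ : ℝ} (hσ : σ ^ 2 = 1) (s : ℝ) :
    (arcPath σ s).re = σ * (1 - 1 / 2 / (1 / 4 + s ^ 2)) := by
  have : Complex.normSq (arcBase σ s) = 1 / 4 + s ^ 2 := by
    rw [Complex.normSq_apply, arcBase_im, arcBase_re]
    linear_combination hσ / 4
  simp only [arcPath, Complex.sub_re, Complex.ofReal_re, one_div, Complex.inv_re, this, arcBase_re]
  ring

lemma continuousAt_phiS {z : ℂ} (hz : 0 < z.im) : ContinuousAt phiS z :=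
  (differentiableAt_phiS hz).continuousAt

lemma isGaussSup_arc {σ : ℝ} (hσ : σ ^ 2 = 1) : IsGaussSup (1 / 2) (arcAmp σ) (arcPath σ) := by
  have hpos : ∀ s : ℝ, 1 / 2 < s → 0 < (arcBase σ s).im := fun s hs => by
    rw [arcBase_im]; linarith
  have hcont : Continuous (arcBase σ) := by unfold arcBase; fun_prop
  refine ⟨le_rfl, ?_, ?_, ?_, ?_, ?_, ?_⟩
  · intro s hs
    have h := hpos s hs
    have h1 : ContinuousAt (fun s => phiS (arcBase σ s)) s :=
      ContinuousAt.comp (continuousAt_phiS h) hcont.continuousAt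
    exact ((h1.const_mul (-I)).div (hcont.continuousAt.pow 12)
      (pow_ne_zero _ (ne_zero_of_im_pos h))).continuousWithinAt
  · intro s hs
    have h := hpos s hs
    exact (continuousAt_const.sub (continuousAt_const.div hcont.continuousAt
      (ne_zero_of_im_pos h))).continuousWithinAt
  · obtain ⟨C, hC, hb⟩ := exists_norm_phiS_le
    refine ⟨C * 2 ^ 12, by positivity, fun s hs => ?_⟩
    have h1 := hb (arcBase σ s) (by rw [arcBase_im]; exact hs.le)
    rw [arcBase_im] at h1
    have h2 : (1 / 2 : ℝ) ≤ ‖arcBase σ s‖ := by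
      have := Complex.abs_im_le_norm (arcBase σ s)
      rw [arcBase_im] at this
      linarith [le_abs_self s]
    rw [arcAmp, norm_div, norm_mul, norm_neg, Complex.norm_I, one_mul, norm_pow]
    calc _ ≤ C * Real.exp (-Real.pi * s) / (1 / 2) ^ 12 := by gcongr
      _ = _ := by ring
  · intro s hs
    rw [arcPath_im hσ, div_le_div_iff₀ (by linarith) (by positivity)]
    nlinarith
  · intro s hs
    rw [arcPath_im hσ, div_le_iff₀ (by positivity)]
    nlinarith [sq_nonneg (s - 1 / 2), mul_pos (sub_pos.mpr hs) (sub_pos.mpr hs)]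
  · intro s hs
    have h1 : |σ| = 1 := by
      rcases (by simpa using hσ : σ = 1 ∨ σ = -1) with h | h <;> simp [h]
    have h2 : 1 / 2 / (1 / 4 + s ^ 2) ≤ 1 := by
      rw [div_le_one (by positivity)]; nlinarith
    have h3 : 0 ≤ 1 / 2 / (1 / 4 + s ^ 2) := by positivity
    rw [arcPath_re hσ, abs_mul, h1, one_mul, abs_le]
    constructor <;> linarith

lemma isGaussSup_cusp : IsGaussSup 1 cuspAmp cuspPath := by
  refine ⟨by norm_num, ?_, ?_, ?_, ?_, ?_, ?_⟩
  · intro s hs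
    have hs : 1 < s := hs
    have hs0 : (s : ℂ) ≠ 0 := by exact_mod_cast (by linarith : s ≠ 0)
    have h1 : ContinuousAt (fun s : ℝ => phiS (I * s)) s :=
      ContinuousAt.comp (f := fun s : ℝ => I * (s : ℂ)) (continuousAt_phiS (by simp; linarith))
        (by fun_prop)
    exact ((h1.const_mul (2 * I)).div (by fun_prop) (pow_ne_zero 12 hs0)).continuousWithinAt
  · intro s hs
    have hs : 1 < s := hs
    have hs0 : (s : ℂ) ≠ 0 := by exact_mod_cast (by linarith : s ≠ 0)
    exact (continuousAt_const.div (by fun_prop) hs0).continuousWithinAt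
  · obtain ⟨C, hC, hb⟩ := exists_norm_phiS_le
    refine ⟨2 * C, by positivity, fun s hs => ?_⟩
    have h1 := hb (I * s) (by simp; linarith)
    simp only [Complex.mul_im, Complex.I_re, Complex.I_im, Complex.ofReal_re, Complex.ofReal_im,
      one_mul, mul_zero, zero_add] at h1
    have h2 : (1 : ℝ) ≤ s ^ 12 := one_le_pow₀ hs.le
    rw [cuspAmp, norm_div, norm_mul, norm_mul, Complex.norm_I, norm_pow, Complex.norm_real,
      Real.norm_of_nonneg (by linarith), Complex.norm_ofNat, mul_one]
    calc _ ≤ 2 * (C * Real.exp (-Real.pi * s)) / 1 := by gcongr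
      _ = _ := by ring
  · intro s hs
    have : (cuspPath s).im = 1 / s := by simp [cuspPath, Complex.div_ofReal_im]
    rw [this]
    apply one_div_le_one_div_of_le <;> linarith
  · intro s hs
    have : (cuspPath s).im = 1 / s := by simp [cuspPath, Complex.div_ofReal_im]
    rw [this, div_le_iff₀ (by linarith)]
    nlinarith
  · intro s hs
    simp [cuspPath, Complex.div_ofReal_re]

lemma isGaussSup_top : IsGaussSup 1 topAmp topPath := by
  refine ⟨by norm_num, ?_, ?_, ?_, ?_, ?_, ?_⟩
  · intro s hs
    have hs : 1 < s := hs
    have h1 : ContinuousAt (fun s : ℝ => phiS (I * s)) s :=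
      ContinuousAt.comp (f := fun s : ℝ => I * (s : ℂ)) (continuousAt_phiS (by simp; linarith))
        (by fun_prop)
    exact (h1.const_mul (-2 * I)).continuousWithinAt
  · unfold topPath; fun_prop
  · obtain ⟨C, hC, hb⟩ := exists_norm_phiS_le
    refine ⟨2 * C, by positivity, fun s hs => ?_⟩
    have h1 := hb (I * s) (by simp; linarith)
    simp only [Complex.mul_im, Complex.I_re, Complex.I_im, Complex.ofReal_re, Complex.ofReal_im,
      one_mul, mul_zero, zero_add] at h1
    rw [topAmp, norm_mul, norm_mul, Complex.norm_I, norm_neg, Complex.norm_ofNat, mul_one]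
    linarith
  · intro s hs
    have : (topPath s).im = s := by simp [topPath]
    rw [this, div_le_iff₀ (by linarith)]
    nlinarith
  · intro s hs
    have : (topPath s).im = s := by simp [topPath]
    linarith
  · intro s hs
    simp [topPath]

/-- With `u = arcBase σ s` and `v = arcBase (-σ) s = u - σ`, the path is `σ v / u`, so dividing by
its 12th power turns `u⁻¹²` into `v⁻¹²`. The minus sign is the antiperiodicity of `phiS`. -/
lemma arcAmp_div_arcPath {σ : ℝ} (hσ : σ ^ 2 = 1) {s : ℝ} (hs : 1 / 2 < s) :
    arcAmp σ s / arcPath σ s ^ 12 = -arcAmp (-σ) s ∧ -1 / arcPath σ s = arcPath (-σ) s := by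
  have hu : 0 < (arcBase σ s).im := by rw [arcBase_im]; linarith
  have hv : 0 < (arcBase (-σ) s).im := by rw [arcBase_im]; linarith
  have hu0 := ne_zero_of_im_pos hu
  have hv0 := ne_zero_of_im_pos hv
  have hσc : (σ : ℂ) ^ 2 = 1 := by exact_mod_cast hσ
  have hσ0 : (σ : ℂ) ≠ 0 := by rintro h; rw [h] at hσc; simp at hσc
  have huv : arcBase σ s = arcBase (-σ) s + σ := by simp [arcBase]; ring
  have hpath : arcPath σ s = σ * arcBase (-σ) s / arcBase σ s := by
    rw [arcPath]
    field_simp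
    rw [huv]
    linear_combination hσc
  have hphi : phiS (arcBase σ s) = -phiS (arcBase (-σ) s) := by
    rcases (by simpa using hσ : σ = 1 ∨ σ = -1) with h | h
    · rw [huv, h]; simpa using! phiS_add_one (by rw [h] at hv; exact hv)
    · have := phiS_add_one hu
      rw [show arcBase (-σ) s = arcBase σ s + 1 by rw [huv, h]; simp, this, neg_neg]
  constructor
  · rw [hpath, arcAmp, arcAmp, hphi, div_pow, mul_pow,
      show (σ : ℂ) ^ 12 = 1 by rw [show 12 = 2 * 6 by norm_num, pow_mul, hσc, one_pow]]
    field_simp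
  · rw [hpath, arcPath]
    field_simp
    rw [huv]
    push_cast
    linear_combination arcBase (-σ) s * hσc

lemma phiI_I_div {s : ℝ} (hs : 0 < s) : phiI (I / s) = -(phiS (I * s) / s ^ 10) := by
  have hs0 : (s : ℂ) ≠ 0 := by exact_mod_cast hs.ne'
  have := phiI_inv (z := I * s) (by simpa using hs)
  rw [show -1 / (I * s) = I / s by field_simp; simp] at this
  rw [this, mul_pow, show I ^ 10 = -1 by
    rw [show 10 = 4 * 2 + 2 by norm_num, pow_add, pow_mul, I_pow_four]; simp]
  field_simp

lemma phiI_sub_sign {σ : ℝ} (hσ : σ ^ 2 = 1) {z : ℂ} (hz : 0 < z.im) :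
    phiI (z - σ) = phiI z - phiS z := by
  rcases (by simpa using hσ : σ = 1 ∨ σ = -1) with h | h
  · rw [h]; simpa using phiI_sub_one hz
  · rw [h]; simpa using phiI_add_one hz

/-! ### The integral along the imaginary axis and the contour shift. -/

/-- The integrand `ψ_I(it) exp (π i ρ (it)) i`. -/
def axisIntegrand (ρ t : ℝ) : ℂ := phiI (I * t) * cexp (Real.pi * I * ρ * (I * t)) * I

lemma continuousOn_axisIntegrand (ρ : ℝ) : ContinuousOn (axisIntegrand ρ) (Set.Ioi 0) := by
  intro t ht
  have ht : 0 < t := ht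
  have h1 : ContinuousAt (fun t : ℝ => phiI (I * t)) t :=
    ContinuousAt.comp (f := fun t : ℝ => I * (t : ℂ))
      (differentiableAt_phiI (by simpa using ht)).continuousAt (by fun_prop)
  exact ((h1.mul (by fun_prop)).mul_const I).continuousWithinAt

lemma norm_cexp_pi_I_ofReal_mul (ρ : ℝ) (z : ℂ) :
    ‖cexp (Real.pi * I * ρ * z)‖ = Real.exp (-Real.pi * ρ * z.im) := by
  rw [norm_cexp_pi_I_mul, Complex.ofReal_re, Complex.ofReal_im]
  ring_nf

/-- `phiI` grows at most like `exp (4πt)`, whence the condition `r > 2`. -/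
lemma integrableOn_axisIntegrand_Ioi_one {ρ : ℝ} (hρ : 4 < ρ) :
    IntegrableOn (axisIntegrand ρ) (Set.Ioi 1) := by
  obtain ⟨C, hC, hb⟩ := exists_norm_phiI_le
  have hπ := Real.pi_pos
  refine Integrable.mono' (IsGaussSup.integrableOn_exp (a := Real.pi * (ρ - 4))
    (mul_pos hπ (by linarith)) C) (((continuousOn_axisIntegrand ρ).mono
      (Set.Ioi_subset_Ioi zero_le_one)).aestronglyMeasurable measurableSet_Ioi) ?_
  filter_upwards [ae_restrict_mem measurableSet_Ioi] with t ht
  have ht : 1 < t := ht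
  have him : (I * (t : ℂ)).im = t := by simp
  have h1 := hb (I * t) (by rw [him]; linarith)
  rw [him] at h1
  rw [axisIntegrand, norm_mul, norm_mul, Complex.norm_I, mul_one, norm_cexp_pi_I_ofReal_mul, him]
  calc _ ≤ C * Real.exp (4 * Real.pi * t) * Real.exp (-Real.pi * ρ * t) := by gcongr
    _ = _ := by rw [mul_assoc, ← Real.exp_add]; ring_nf

lemma axisIntegrand_one_div (ρ : ℝ) {s : ℝ} (hs : 0 < s) :
    ((1 / s ^ 2 : ℝ) : ℂ) * axisIntegrand ρ (1 / s) =
      -(1 / 2) * (cuspAmp s * cexp (Real.pi * I * ρ * cuspPath s)) := by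
  have hs0 : (s : ℂ) ≠ 0 := by exact_mod_cast hs.ne'
  have h : I * ((1 / s : ℝ) : ℂ) = I / s := by push_cast; ring
  rw [axisIntegrand, h, phiI_I_div hs, cuspAmp, cuspPath]
  push_cast
  field_simp

lemma axisIntegrand_integral {ρ : ℝ} (hρ : 4 < ρ) :
    IntegrableOn (axisIntegrand ρ) (Set.Ioi 0) ∧
    ∫ t in Set.Ioi 0, axisIntegrand ρ t = (∫ t in Set.Ioi 1, axisIntegrand ρ t) -
      1 / 2 * gaussSup 1 cuspAmp cuspPath ρ := by
  have hcusp := isGaussSup_cusp.integrableOn (w := ρ) (by rw [Complex.ofReal_re]; linarith)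
  have heq : Set.EqOn (fun s : ℝ => ((1 / s ^ 2 : ℝ) : ℂ) * axisIntegrand ρ (1 / s))
      (fun s => -(1 / 2) * (cuspAmp s * cexp (Real.pi * I * ρ * cuspPath s))) (Set.Ioi 1) :=
    fun s hs => axisIntegrand_one_div ρ (zero_lt_one.trans hs)
  have h := integral_Ioi_zero_eq_add (integrableOn_axisIntegrand_Ioi_one hρ)
    ((integrableOn_congr_fun heq measurableSet_Ioi).mpr (hcusp.const_mul _))
  refine ⟨h.1, ?_⟩
  rw [h.2, setIntegral_congr_fun measurableSet_Ioi heq, integral_const_mul, gaussSup]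
  ring

/-- The contour shift: the vertical line from `σ = ±1` to `σ + i∞` is replaced by the arc from `σ`
to `i` followed by the vertical line from `i` to `i∞`. -/
lemma contour_shift {ρ σ : ℝ} (hρ : 4 < ρ) (hσ : σ ^ 2 = 1) :
    cexp (Real.pi * I * ρ * σ) * ∫ t in Set.Ioi 0, axisIntegrand ρ t =
      gaussSup (1 / 2) (arcAmp σ) (arcPath σ) ρ + (∫ t in Set.Ioi 1, axisIntegrand ρ t) +
        1 / 2 * gaussSup 1 topAmp topPath ρ := by
  have hπ := Real.pi_pos
  have hρre : -(3 / 4) < (ρ : ℂ).re := by rw [Complex.ofReal_re]; linarith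
  set f : ℂ → ℂ := fun z => (phiI z - phiS z) * cexp (Real.pi * I * ρ * z) with hf
  obtain ⟨F, hF⟩ := exists_primitive_upperHalfPlane (f := f) fun z hz =>
    ((differentiableAt_phiI hz).sub (differentiableAt_phiS hz)).mul (by fun_prop)
  -- the vertical line above `σ + i`
  have hline : ∀ (a : ℝ) (t : ℝ), 0 < t → HasDerivAt (fun t : ℝ => F (a + I * t))
      (f (a + I * t) * I) t := by
    intro a t ht
    have h1 : HasDerivAt (fun z : ℂ => (a : ℂ) + I * z) I (t : ℂ) := by
      simpa using ((hasDerivAt_id (t : ℂ)).const_mul I).const_add (a : ℂ)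
    have h2 : HasDerivAt F (f (a + I * t)) (a + I * t) := hF _ (by simpa using ht)
    exact (HasDerivAt.comp (t : ℂ) h2 h1).comp_ofReal
  have hE : ∀ z : ℂ, cexp (Real.pi * I * ρ * (σ + z)) =
      cexp (Real.pi * I * ρ * σ) * cexp (Real.pi * I * ρ * z) := fun z => by
    rw [← Complex.exp_add]; ring_nf
  have hfσ : ∀ z : ℂ, 0 < z.im →
      f (σ + z) = cexp (Real.pi * I * ρ * σ) * (phiI z * cexp (Real.pi * I * ρ * z)) := by
    intro z hz
    have h := phiI_sub_sign hσ (z := σ + z) (by simpa using hz)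
    rw [add_sub_cancel_left] at h
    simp only [hf]
    rw [← h, hE]
    ring
  have eq1 : ∀ t : ℝ, 0 < t →
      f (σ + I * t) * I = cexp (Real.pi * I * ρ * σ) * axisIntegrand ρ t := by
    intro t ht
    rw [hfσ _ (by simpa using ht), axisIntegrand]
    ring
  have int1 : IntegrableOn (fun t : ℝ => f (σ + I * t) * I) (Set.Ioi 1) :=
    (integrableOn_congr_fun (fun t ht => eq1 t (zero_lt_one.trans ht)) measurableSet_Ioi).mpr
      ((integrableOn_axisIntegrand_Ioi_one hρ).const_mul _)
  obtain ⟨L₁, hL₁, I₁⟩ := exists_integral_Ioi_eq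
    (fun t ht => hline σ t (zero_lt_one.trans_le ht)) int1
  have eq2 : ∀ t : ℝ, 0 < t → f ((0 : ℝ) + I * t) * I = axisIntegrand ρ t +
      1 / 2 * (topAmp t * cexp (Real.pi * I * ρ * topPath t)) := by
    intro t ht
    simp only [hf, axisIntegrand, topAmp, topPath, Complex.ofReal_zero, zero_add]
    ring
  have htop := isGaussSup_top.integrableOn hρre
  have int2 : IntegrableOn (fun t : ℝ => f ((0 : ℝ) + I * t) * I) (Set.Ioi 1) :=
    (integrableOn_congr_fun (fun t ht => eq2 t (zero_lt_one.trans ht)) measurableSet_Ioi).mpr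
      ((integrableOn_axisIntegrand_Ioi_one hρ).add (htop.const_mul _))
  obtain ⟨L₂, hL₂, I₂⟩ := exists_integral_Ioi_eq
    (fun t ht => hline 0 t (zero_lt_one.trans_le ht)) int2
  -- the neighbourhood of the cusp `σ`, in the coordinate `u = -1 / (z - σ)`
  have hinv_im : ∀ u : ℂ, 0 < u.im → 0 < ((-1 : ℂ) / u).im := by
    intro u hu
    have := Complex.normSq_pos.mpr (ne_zero_of_im_pos hu)
    rw [neg_div, Complex.neg_im, one_div, Complex.inv_im, neg_div, neg_neg]
    positivity
  -- The pullback of `f dz`: weight `-10` gives `u⁻¹⁰` and `dz = du / u²` gives the rest. Near the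
  -- cusp `σ` only the decaying `phiS` is seen.
  set k : ℂ → ℂ := fun u => phiS u / u ^ 12 * cexp (Real.pi * I * ρ * (σ + -1 / u)) with hk
  have hK : ∀ u : ℂ, 0 < u.im → HasDerivAt (fun u => F (σ + -1 / u)) (k u) u := by
    intro u hu
    have hu0 := ne_zero_of_im_pos hu
    have h1 : HasDerivAt (fun u : ℂ => (σ : ℂ) + -1 / u) (1 / u ^ 2) u := by
      have := ((hasDerivAt_inv hu0).const_mul (-1 : ℂ)).const_add (σ : ℂ)
      simpa [div_eq_mul_inv] using this
    have h2 : HasDerivAt F (f (σ + -1 / u)) (σ + -1 / u) := hF _ (by simpa using hinv_im u hu)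
    refine (HasDerivAt.comp u h2 h1).congr_deriv ?_
    rw [hfσ _ (hinv_im u hu), phiI_inv hu, hk]
    simp only
    rw [hE]
    field_simp
  have hKline : ∀ (a : ℝ) (t : ℝ), 0 < t →
      HasDerivAt (fun t : ℝ => F (σ + -1 / (a + I * t))) (k (a + I * t) * I) t := by
    intro a t ht
    have h1 : HasDerivAt (fun z : ℂ => (a : ℂ) + I * z) I (t : ℂ) := by
      simpa using ((hasDerivAt_id (t : ℂ)).const_mul I).const_add (a : ℂ)
    have h2 := hK (a + I * t) (by simpa using ht)
    exact (HasDerivAt.comp (t : ℂ) h2 h1).comp_ofReal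
  have eq3 : ∀ s : ℝ, 0 < s → k ((0 : ℝ) + I * s) * I = cexp (Real.pi * I * ρ * σ) *
      (1 / 2 * (cuspAmp s * cexp (Real.pi * I * ρ * cuspPath s))) := by
    intro s hs
    have hs0 : (s : ℂ) ≠ 0 := by exact_mod_cast hs.ne'
    simp only [hk, Complex.ofReal_zero, zero_add]
    rw [hE, show -1 / (I * s) = I / s by field_simp; simp, cuspAmp, cuspPath, mul_pow,
      show I ^ 12 = 1 by rw [show 12 = 4 * 3 by norm_num, pow_mul, I_pow_four, one_pow]]
    field_simp
  have hcusp := isGaussSup_cusp.integrableOn hρre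
  have int3 : IntegrableOn (fun s : ℝ => k ((0 : ℝ) + I * s) * I) (Set.Ioi 1) :=
    (integrableOn_congr_fun (fun t ht => eq3 t (zero_lt_one.trans ht)) measurableSet_Ioi).mpr
      ((hcusp.const_mul _).const_mul _)
  obtain ⟨L₃, hL₃, I₃⟩ := exists_integral_Ioi_eq
    (fun t ht => hKline 0 t (zero_lt_one.trans_le ht)) int3
  have eq4 : ∀ s : ℝ, k ((σ / 2 : ℝ) + I * s) * I =
      -(arcAmp σ s * cexp (Real.pi * I * ρ * arcPath σ s)) := by
    intro s
    have : (((σ / 2 : ℝ) : ℂ) + I * s) = arcBase σ s := by rw [arcBase]; push_cast; rfl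
    simp only [this, hk]
    rw [arcAmp, arcPath, sub_eq_add_neg, neg_div]
    ring
  have harc := (isGaussSup_arc hσ).integrableOn hρre
  have int4 : IntegrableOn (fun s : ℝ => k ((σ / 2 : ℝ) + I * s) * I) (Set.Ioi (1 / 2)) := by
    simp_rw [eq4]
    exact harc.neg
  obtain ⟨L₄, hL₄, I₄⟩ := exists_integral_Ioi_eq
    (fun t ht => hKline (σ / 2) t (by have : 1 / 2 ≤ t := ht; linarith)) int4
  -- the limits agree
  have hL12 : L₁ = L₂ := by
    obtain ⟨C, hC, hb⟩ := exists_norm_phiI_le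
    obtain ⟨D, hD, hd⟩ := exists_norm_phiS_le
    have hη : Tendsto (fun t : ℝ => (C + D) * Real.exp (-(Real.pi * (ρ - 4)) * t)) atTop (𝓝 0) := by
      have : Tendsto (fun t : ℝ => Real.exp (-(Real.pi * (ρ - 4)) * t)) atTop (𝓝 0) :=
        Real.tendsto_exp_atBot.comp (tendsto_id.const_mul_atTop_of_neg
          (by have := mul_pos hπ (by linarith : 0 < ρ - 4); linarith))
      simpa using this.const_mul (C + D)
    have := tendsto_sub_horizontal hF (fun z hz => ?_) hη σ 0
    · exact sub_eq_zero.mp (tendsto_nhds_unique (hL₁.sub hL₂) this)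
    · have h1 := hb z (by linarith)
      have h2 := hd z (by linarith)
      have h3 : Real.exp (-Real.pi * z.im) ≤ Real.exp (4 * Real.pi * z.im) := by
        apply Real.exp_le_exp.mpr; nlinarith
      simp only [hf]
      rw [norm_mul, norm_cexp_pi_I_ofReal_mul]
      calc _ ≤ ((C + D) * Real.exp (4 * Real.pi * z.im)) * Real.exp (-Real.pi * ρ * z.im) := by
            gcongr
            refine (norm_sub_le _ _).trans ?_
            nlinarith
        _ = _ := by rw [mul_assoc, ← Real.exp_add]; ring_nf
  have hL34 : L₃ = L₄ := by
    obtain ⟨D, hD, hd⟩ := exists_norm_phiS_le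
    have hη : Tendsto (fun t : ℝ => D * Real.exp (-Real.pi * t)) atTop (𝓝 0) := by
      have : Tendsto (fun t : ℝ => Real.exp (-Real.pi * t)) atTop (𝓝 0) :=
        Real.tendsto_exp_atBot.comp (tendsto_id.const_mul_atTop_of_neg (by linarith))
      simpa using this.const_mul D
    have := tendsto_sub_horizontal hK (fun u hu => ?_) hη 0 (σ / 2)
    · exact sub_eq_zero.mp (tendsto_nhds_unique (hL₃.sub hL₄) this)
    · have hu0 : 0 < u.im := by linarith
      have h1 := hd u (by linarith)
      have h2 : 1 ≤ ‖u‖ ^ 12 := one_le_pow₀ (hu.trans ((le_abs_self _).trans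
        (Complex.abs_im_le_norm u)))
      have h3 : ‖cexp (Real.pi * I * ρ * (σ + -1 / u))‖ ≤ 1 := by
        rw [norm_cexp_pi_I_ofReal_mul, Real.exp_le_one_iff]
        have h4 : 0 < ((σ : ℂ) + -1 / u).im := by simpa using hinv_im u hu0
        have : 0 < Real.pi * ρ * ((σ : ℂ) + -1 / u).im := by positivity
        linarith
      simp only [hk]
      rw [norm_mul, norm_div, norm_pow]
      calc _ ≤ (D * Real.exp (-Real.pi * u.im)) / 1 * 1 := by gcongr
        _ = _ := by ring
  -- the starting points
  have hstart1 : (σ : ℂ) + -1 / ((0 : ℝ) + I * (1 : ℝ)) = σ + I * (1 : ℝ) := by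
    simp [neg_div]
  have hstart2 : (σ : ℂ) + -1 / ((σ / 2 : ℝ) + I * (1 / 2 : ℝ)) = (0 : ℝ) + I * (1 : ℝ) := by
    have hσc : (σ : ℂ) ^ 2 = 1 := by exact_mod_cast hσ
    have hne : (σ : ℂ) + I ≠ 0 := fun h => by simpa using congrArg Complex.im h
    push_cast
    rw [show (σ : ℂ) / 2 + I * (1 / 2) = (σ + I) / 2 by ring]
    field_simp
    linear_combination hσc - I_sq
  rw [hstart1] at I₃
  rw [hstart2] at I₄
  rw [setIntegral_congr_fun measurableSet_Ioi (fun t ht => eq1 t (zero_lt_one.trans ht)),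
    integral_const_mul] at I₁
  rw [setIntegral_congr_fun measurableSet_Ioi (fun t ht => eq2 t (zero_lt_one.trans ht)),
    integral_add (integrableOn_axisIntegrand_Ioi_one hρ) (htop.const_mul _),
    integral_const_mul] at I₂
  rw [setIntegral_congr_fun measurableSet_Ioi (fun t ht => eq3 t (zero_lt_one.trans ht)),
    integral_const_mul, integral_const_mul] at I₃
  simp_rw [eq4] at I₄
  rw [integral_neg] at I₄
  rw [(axisIntegrand_integral hρ).2, gaussSup, gaussSup, gaussSup]
  -- The values of the primitive at `σ + i` and at `i` cancel, and `hL12`, `hL34` identify the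
  -- limits at `i∞` and at `σ`.
  linear_combination I₁ - I₃ - I₂ + I₄ + hL12 - hL34

/-! ### Positivity on the imaginary axis. -/

lemma exists_th01_I_mul_eq (t : ℝ) : ∃ x : ℝ, th01 (I * t) = x := by
  have := jacobiTheta₂_conj (1 / 2) (I * t)
  refine Complex.conj_eq_iff_real.mp ?_
  rw [th01, this]
  simp [Complex.conj_ofNat]

lemma exists_th10_I_mul_eq (t : ℝ) : ∃ x : ℝ, th10 (I * t) = x := by
  have h1 := jacobiTheta₂_conj (I * t / 2) (I * t)
  have h2 : cexp (Real.pi * I * (I * t) / 4) = ((Real.exp (-(Real.pi * t / 4)) : ℝ) : ℂ) := by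
    push_cast
    congr 1
    linear_combination (Real.pi * t / 4 : ℂ) * I_sq
  refine Complex.conj_eq_iff_real.mp ?_
  rw [th10, h2, map_mul, h1, Complex.conj_ofReal]
  congr 1
  rw [← jacobiTheta₂_neg_left]
  simp [neg_div, Complex.conj_ofNat]

lemma exists_disc_I_mul_eq {t : ℝ} (ht : 0 < t) : ∃ x : ℝ, disc (I * t) = x := by
  have hq : ∀ h : ℝ, (starRingEnd ℂ) (Function.Periodic.qParam h (I * t)) =
      Function.Periodic.qParam h (I * t) := by
    intro h
    rw [Function.Periodic.qParam, ← Complex.exp_conj]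
    simp [Complex.conj_ofNat]
  have hmul := (ModularForm.multipliableLocallyUniformlyOn_eta.multipliable
    (x := I * (t : ℂ)) (by simpa [upperHalfPlaneSet] using ht))
  refine Complex.conj_eq_iff_real.mp ?_
  rw [disc, map_pow, ModularForm.eta, map_mul, hq,
    hmul.map_tprod (starRingEnd ℂ) Complex.continuous_conj]
  simp [ModularForm.eta_q, hq]

/-- The theta values and the discriminant are real there and enter `phiI` only through even powers
with positive coefficients. -/
lemma exists_phiI_I_mul_eq {t : ℝ} (ht : 0 < t) :
    ∃ p : ℝ, phiI (I * t) = p ∧ 0 ≤ p ∧ (th01 (I * t) ≠ 0 → 0 < p) := by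
  obtain ⟨x, hx⟩ := exists_th01_I_mul_eq t
  obtain ⟨y, hy⟩ := exists_th10_I_mul_eq t
  obtain ⟨d, hd⟩ := exists_disc_I_mul_eq ht
  have hd0 : d ≠ 0 := by
    rintro rfl
    exact disc_ne_zero (z := I * t) (by simpa using ht) (by simpa using hd)
  have e1 : 0 ≤ x ^ 20 * y ^ 8 := by positivity
  have e2 : 0 ≤ x ^ 24 * y ^ 4 := by positivity
  refine ⟨(7 * x ^ 20 * y ^ 8 + 7 * x ^ 24 * y ^ 4 + 2 * x ^ 28) / d ^ 2, ?_, ?_, fun h => ?_⟩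
  · rw [phiI, hx, hy, hd]; push_cast; rfl
  · exact div_nonneg (by positivity) (by positivity)
  · have hx0 : x ≠ 0 := fun h0 => h (by rw [hx, h0]; simp)
    have e3 : 0 < x ^ 28 := by positivity
    exact div_pos (by linarith) (by positivity)

lemma integral_axisIntegrand_ne_zero {ρ : ℝ} (hρ : 4 < ρ) :
    ∫ t in Set.Ioi 0, axisIntegrand ρ t ≠ 0 := by
  set p : ℝ → ℝ := fun t => (phiI (I * t)).re * Real.exp (-Real.pi * ρ * t) with hp
  have hint := (axisIntegrand_integral hρ).1
  have heq : Set.EqOn (axisIntegrand ρ) (fun t => (p t : ℂ) * I) (Set.Ioi 0) := by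
    intro t ht
    obtain ⟨q, hq, -, -⟩ := exists_phiI_I_mul_eq (t := t) ht
    have : cexp (Real.pi * I * ρ * (I * t)) = ((Real.exp (-Real.pi * ρ * t) : ℝ) : ℂ) := by
      push_cast
      congr 1
      linear_combination (Real.pi * ρ * t : ℂ) * I_sq
    simp only [axisIntegrand, hp]
    rw [hq, this, Complex.ofReal_re]
    push_cast
    ring
  have hpint : IntegrableOn p (Set.Ioi 0) := by
    have h1 := ((integrableOn_congr_fun heq measurableSet_Ioi).mp hint).mul_const (-I)
    have h2 := h1.re
    refine h2.congr (Eventually.of_forall fun t => ?_)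
    simp [mul_assoc]
  have hpos : 0 < ∫ t in Set.Ioi 0, p t := by
    rw [setIntegral_pos_iff_support_of_nonneg_ae ?_ hpint]
    -- Since `th01 → 1` at `i∞`, the integrand is strictly positive on a half-line, a set of
    -- positive measure.
    · obtain ⟨K, hK, hb⟩ := exists_norm_th01_sub_one_le
      have hlim : Tendsto (fun t : ℝ => K * Real.exp (-Real.pi * t)) atTop (𝓝 0) := by
        have : Tendsto (fun t : ℝ => Real.exp (-Real.pi * t)) atTop (𝓝 0) :=
          Real.tendsto_exp_atBot.comp (tendsto_id.const_mul_atTop_of_neg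
            (by linarith [Real.pi_pos]))
        simpa using this.const_mul K
      obtain ⟨T, hT⟩ := eventually_atTop.mp (hlim.eventually_lt_const one_pos)
      refine lt_of_lt_of_le (by simp : (0 : ENNReal) < volume (Set.Ioi (max T 1)))
        (measure_mono fun t ht => ?_)
      have ht : max T 1 < t := ht
      have htT : T < t := (le_max_left _ _).trans_lt ht
      have ht1 : 1 < t := (le_max_right _ _).trans_lt ht
      have ht0 : 0 < t := by linarith
      refine ⟨?_, ht0⟩
      obtain ⟨q, hq, -, hq0⟩ := exists_phiI_I_mul_eq ht0
      have hne : th01 (I * t) ≠ 0 := by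
        intro h0
        have him : (I * (t : ℂ)).im = t := by simp
        have h1 := hb (I * t) (by rw [him]; linarith)
        rw [h0, zero_sub, norm_neg, norm_one, him] at h1
        linarith [hT t htT.le]
      have := hq0 hne
      simp only [Function.mem_support, hp, hq, Complex.ofReal_re]
      positivity
    · filter_upwards [ae_restrict_mem measurableSet_Ioi] with t ht
      obtain ⟨q, hq, hq0, -⟩ := exists_phiI_I_mul_eq (t := t) ht
      simp only [hp, hq, Complex.ofReal_re, Pi.zero_apply]
      positivity
  rw [setIntegral_congr_fun measurableSet_Ioi heq, integral_mul_const]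
  refine mul_ne_zero ?_ I_ne_zero
  rw [integral_complex_ofReal]
  exact_mod_cast hpos.ne'

/-! ### The continuation of `b` and its Fourier transform. -/

lemma bIntegrand_eq_axisIntegrand (r : ℝ) {t : ℝ} (ht : 0 < t) :
    bIntegrand r (I * t) * I = axisIntegrand (r ^ 2) t := by
  rw [bIntegrand, psiI_ofComplex (by simpa using ht), axisIntegrand]
  push_cast
  rfl

/-- The continuation of `b` as a function of `w = r²`. -/
def bCont (w : ℂ) : ℂ :=
  gaussSup (1 / 2) (arcAmp 1) (arcPath 1) w + gaussSup (1 / 2) (arcAmp (-1)) (arcPath (-1)) w +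
    (gaussSup 1 cuspAmp cuspPath w + gaussSup 1 topAmp topPath w)

lemma b_eq (r : ℝ) : b r = -4 * ((Real.sin (Real.pi * r ^ 2 / 2) : ℝ) : ℂ) ^ 2 *
    ∫ t in Set.Ioi 0, axisIntegrand (r ^ 2) t := by
  rw [b, setIntegral_congr_fun measurableSet_Ioi fun t ht => bIntegrand_eq_axisIntegrand r ht]

/-- Add the contour shifts for `σ = 1` and `σ = -1` and subtract twice the unshifted integral: the
integrals of `phiI` over the ray above `i`, which do not continue termwise, cancel. -/
lemma bCont_eq {r : ℝ} (hr : 2 < r) : bCont ((r : ℂ) ^ 2) = b r := by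
  have hρ : 4 < r ^ 2 := by nlinarith
  have h1 := contour_shift hρ (σ := 1) (by norm_num)
  have h2 := contour_shift hρ (σ := -1) (by norm_num)
  have h3 := (axisIntegrand_integral hρ).2
  have htrig : (-4 * ((Real.sin (Real.pi * r ^ 2 / 2) : ℝ) : ℂ) ^ 2) =
      cexp (Real.pi * I * (r ^ 2 : ℝ) * (1 : ℝ)) +
        cexp (Real.pi * I * (r ^ 2 : ℝ) * (-1 : ℝ)) - 2 := by
    have e1 : cexp (Real.pi * I * (r ^ 2 : ℝ) * (1 : ℝ)) =
        cexp ((Real.pi * r ^ 2 / 2 : ℂ) * I) ^ 2 := by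
      rw [← Complex.exp_nat_mul]; congr 1; push_cast; ring
    have e2 : cexp (Real.pi * I * (r ^ 2 : ℝ) * (-1 : ℝ)) =
        cexp (-(Real.pi * r ^ 2 / 2 : ℂ) * I) ^ 2 := by
      rw [← Complex.exp_nat_mul]; congr 1; push_cast; ring
    have e3 : cexp ((Real.pi * r ^ 2 / 2 : ℂ) * I) * cexp (-(Real.pi * r ^ 2 / 2 : ℂ) * I) = 1 := by
      rw [← Complex.exp_add]; simp
    rw [e1, e2]
    push_cast
    rw [Complex.sin]
    linear_combination (2 * I ^ 2) * e3 + (cexp ((Real.pi * r ^ 2 / 2 : ℂ) * I) ^ 2 +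
      cexp (-(Real.pi * r ^ 2 / 2 : ℂ) * I) ^ 2 - 2) * (-I_sq)
  rw [b_eq, htrig, bCont, show (r : ℂ) ^ 2 = ((r ^ 2 : ℝ) : ℂ) by push_cast; rfl]
  linear_combination -h1 - h2 + 2 * h3

lemma isGaussSup_arc_one : IsGaussSup (1 / 2) (arcAmp 1) (arcPath 1) :=
  isGaussSup_arc (by norm_num)

lemma isGaussSup_arc_neg_one : IsGaussSup (1 / 2) (arcAmp (-1)) (arcPath (-1)) :=
  isGaussSup_arc (by norm_num)

lemma differentiableOn_bCont : DifferentiableOn ℂ bCont {w | -(3 / 4) < w.re} :=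
  (isGaussSup_arc_one.differentiableOn.add isGaussSup_arc_neg_one.differentiableOn).add
    (isGaussSup_cusp.differentiableOn.add isGaussSup_top.differentiableOn)

lemma gaussSup_congr_neg {c : ℝ} {h γ h' γ' : ℝ → ℂ}
    (hh : ∀ s, c < s → h s = -h' s ∧ γ s = γ' s) (w : ℂ) :
    gaussSup c h γ w = -gaussSup c h' γ' w := by
  rw [gaussSup, gaussSup, ← integral_neg]
  refine setIntegral_congr_fun measurableSet_Ioi fun s hs => ?_
  obtain ⟨h1, h2⟩ := hh s hs
  simp only [h1, h2]
  ring

lemma gaussSup_arc_transform {σ : ℝ} (hσ : σ ^ 2 = 1) (w : ℂ) :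
    gaussSup (1 / 2) (fun s => arcAmp σ s / arcPath σ s ^ 12) (fun s => -1 / arcPath σ s) w =
      -gaussSup (1 / 2) (arcAmp (-σ)) (arcPath (-σ)) w :=
  gaussSup_congr_neg (fun _ hs => arcAmp_div_arcPath hσ hs) w

/-- Inversion sends `i / s` to `i s`, and dividing by `(i / s)¹²` removes the `s⁻¹²` in `cuspAmp`.
-/
lemma gaussSup_cusp_transform (w : ℂ) :
    gaussSup 1 (fun s => cuspAmp s / cuspPath s ^ 12) (fun s => -1 / cuspPath s) w =
      -gaussSup 1 topAmp topPath w := by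
  refine gaussSup_congr_neg (fun s hs => ?_) w
  have hs0 : (s : ℂ) ≠ 0 := by exact_mod_cast (by linarith : s ≠ 0)
  have hI : I ^ 12 = 1 := by rw [show 12 = 4 * 3 by norm_num, pow_mul, I_pow_four, one_pow]
  rw [cuspAmp, cuspPath, topAmp, topPath, div_pow, hI]
  constructor
  · field_simp
  · field_simp
    simp

lemma gaussSup_top_transform (w : ℂ) :
    gaussSup 1 (fun s => topAmp s / topPath s ^ 12) (fun s => -1 / topPath s) w =
      -gaussSup 1 cuspAmp cuspPath w := by
  refine gaussSup_congr_neg (fun s hs => ?_) w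
  have hs0 : (s : ℂ) ≠ 0 := by exact_mod_cast (by linarith : s ≠ 0)
  have hI : I ^ 12 = 1 := by rw [show 12 = 4 * 3 by norm_num, pow_mul, I_pow_four, one_pow]
  rw [cuspAmp, cuspPath, topAmp, topPath, mul_pow, hI]
  constructor
  · field_simp
  · field_simp
    simp

lemma exists_schwartz_bCont (E : Type*) [NormedAddCommGroup E] [InnerProductSpace ℝ E] :
    ∃ f : 𝓢(E, ℂ), ∀ x : E, f x = bCont ((‖x‖ ^ 2 : ℝ) : ℂ) := by
  obtain ⟨f₁, h₁⟩ := isGaussSup_arc_one.exists_schwartz E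
  obtain ⟨f₂, h₂⟩ := isGaussSup_arc_neg_one.exists_schwartz E
  obtain ⟨f₃, h₃⟩ := isGaussSup_cusp.exists_schwartz E
  obtain ⟨f₄, h₄⟩ := isGaussSup_top.exists_schwartz E
  exact ⟨f₁ + f₂ + (f₃ + f₄), fun x => by simp only [_root_.add_apply, h₁, h₂, h₃, h₄, bCont]⟩

lemma fourier_bCont {E : Type*} [NormedAddCommGroup E] [InnerProductSpace ℝ E]
    [FiniteDimensional ℝ E] [MeasurableSpace E] [BorelSpace E] (hE : Module.finrank ℝ E = 24)
    {g : 𝓢(E, ℂ)} (hg : ∀ x : E, g x = bCont ((‖x‖ ^ 2 : ℝ) : ℂ)) :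
    𝓕 g = (-1 : ℂ) • g := by
  obtain ⟨f₁, h₁⟩ := isGaussSup_arc_one.exists_schwartz E
  obtain ⟨f₂, h₂⟩ := isGaussSup_arc_neg_one.exists_schwartz E
  obtain ⟨f₃, h₃⟩ := isGaussSup_cusp.exists_schwartz E
  obtain ⟨f₄, h₄⟩ := isGaussSup_top.exists_schwartz E
  have hsum : g = f₁ + f₂ + (f₃ + f₄) := by
    ext x
    simp only [_root_.add_apply, h₁, h₂, h₃, h₄, hg, bCont]
  have t₁ : 𝓕 f₁ = -f₂ := by
    ext y
    rw [SchwartzMap.fourier_coe, funext h₁, isGaussSup_arc_one.fourier_eq hE,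
      gaussSup_arc_transform (by norm_num), _root_.neg_apply, h₂]
  have t₂ : 𝓕 f₂ = -f₁ := by
    ext y
    rw [SchwartzMap.fourier_coe, funext h₂, isGaussSup_arc_neg_one.fourier_eq hE,
      gaussSup_arc_transform (by norm_num), _root_.neg_apply, h₁, neg_neg]
  have t₃ : 𝓕 f₃ = -f₄ := by
    ext y
    rw [SchwartzMap.fourier_coe, funext h₃, isGaussSup_cusp.fourier_eq hE,
      gaussSup_cusp_transform, _root_.neg_apply, h₄]
  have t₄ : 𝓕 f₄ = -f₃ := by
    ext y
    rw [SchwartzMap.fourier_coe, funext h₄, isGaussSup_top.fourier_eq hE,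
      gaussSup_top_transform, _root_.neg_apply, h₃]
  rw [hsum, FourierTransform.fourier_add, FourierTransform.fourier_add,
    FourierTransform.fourier_add, t₁, t₂, t₃, t₄]
  module

end LeechEigenfunction

end

theorem lemma3 :
    -- the integral defining `b(r)` converges absolutely for `r > 2`
    (∀ r : ℝ, 2 < r → MeasureTheory.IntegrableOn
      (fun t : ℝ => LeechEigenfunction.bIntegrand r (Complex.I * (t : ℂ)) * Complex.I)
      (Set.Ioi 0)) ∧
    -- `b` continues to a holomorphic function `B` on an open neighborhood `U` of `ℝ`
    ∃ (U : Set ℂ) (B : ℂ → ℂ),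
      IsOpen U ∧ (∀ r : ℝ, (r : ℂ) ∈ U) ∧ DifferentiableOn ℂ B U ∧
      (∀ r : ℝ, 2 < r → B (r : ℂ) = LeechEigenfunction.b r) ∧
      -- the restriction of `B` to `ℝ` is a Schwartz function
      (∃ f : 𝓢(ℝ, ℂ), ∀ r : ℝ, f r = B (r : ℂ)) ∧
      -- `x ↦ B(|x|)` is an eigenfunction of the Fourier transform in dimension 24
      (∃ g : 𝓢(EuclideanSpace ℝ (Fin 24), ℂ),
        (∀ x : EuclideanSpace ℝ (Fin 24), g x = B ((‖x‖ : ℝ) : ℂ)) ∧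
        g ≠ 0 ∧ 𝓕 g = (-1 : ℂ) • g) := by
  -- The neighbourhood is the preimage under squaring of the half-plane where `bCont` is
  -- holomorphic; it contains `ℝ` because real squares are nonnegative.
  refine ⟨fun r hr => ?_, {z | -(3 / 4) < (z ^ 2).re}, fun z => LeechEigenfunction.bCont (z ^ 2), ?_, ?_, ?_,
    fun r hr => LeechEigenfunction.bCont_eq hr, ?_, ?_⟩
  · have h := (LeechEigenfunction.axisIntegrand_integral (ρ := r ^ 2) (by nlinarith)).1
    exact (MeasureTheory.integrableOn_congr_fun
      (fun t ht => LeechEigenfunction.bIntegrand_eq_axisIntegrand r ht) measurableSet_Ioi).mpr h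
  · exact isOpen_lt continuous_const (Complex.continuous_re.comp (continuous_pow 2))
  · intro r
    have : ((r : ℂ) ^ 2).re = r ^ 2 := by rw [← Complex.ofReal_pow, Complex.ofReal_re]
    show -(3 / 4) < ((r : ℂ) ^ 2).re
    rw [this]
    nlinarith [sq_nonneg r]
  · exact LeechEigenfunction.differentiableOn_bCont.comp (differentiable_pow 2).differentiableOn fun z hz => hz
  · obtain ⟨f, hf⟩ := LeechEigenfunction.exists_schwartz_bCont ℝ
    refine ⟨f, fun r => ?_⟩
    rw [hf, Real.norm_eq_abs, sq_abs, Complex.ofReal_pow]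
  · obtain ⟨g, hg⟩ := LeechEigenfunction.exists_schwartz_bCont (EuclideanSpace ℝ (Fin 24))
    refine ⟨g, fun x => by rw [hg, Complex.ofReal_pow], fun h0 => ?_,
      LeechEigenfunction.fourier_bCont finrank_euclideanSpace_fin hg⟩
    -- A radius beyond `2`, where the integral formula is valid, with `sin (5π/2) = 1`, so the sine
    -- factor does not vanish.
    have hr : 2 < √5 := Real.lt_sqrt_of_sq_lt (by norm_num)
    have hsq : √5 ^ 2 = 5 := Real.sq_sqrt (by norm_num)
    have hx := hg (PiLp.single 2 (0 : Fin 24) √5)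
    rw [h0, PiLp.norm_single, Real.norm_of_nonneg (Real.sqrt_nonneg 5),
      Complex.ofReal_pow, LeechEigenfunction.bCont_eq hr, LeechEigenfunction.b_eq, hsq] at hx
    have hsin : Real.sin (Real.pi * 5 / 2) = 1 := by
      rw [show Real.pi * 5 / 2 = Real.pi / 2 + 2 * Real.pi by ring, Real.sin_add_two_pi,
        Real.sin_pi_div_two]
    rw [hsin] at hx
    have hJ := LeechEigenfunction.integral_axisIntegrand_ne_zero (ρ := 5) (by norm_num)
    simp at hx
    exact hJ hx
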